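/- **Conventions.** $\mathrm{vec}$ stacks the columns of a matrix, $\otimes$ is the Kronecker product, and $C_{p,q}$ is the commutation matrix: $C_{p,q}\mathrm{vec}(M)=\mathrm{vec}(M^{\sf T})$ for $M\in\mathbb R^{p\times q}$. For a matrix function $H$ of a matrix variable $Y$, $\frac{dH}{dY}:=\frac{d\,\mathrm{vec}(H)}{d\,\mathrm{vec}(Y)}$ is the Jacobian matrix (partial derivatives $\partial H/\partial Y$ likewise, the other arguments being fixed), and $\frac{\partial^2H}{\partial D\partial L}:=\frac{\partial}{\partial D}\big(\frac{\partial H}{\partial L}\big)$. $M^\dagger$ is the Moore–Penrose pseudoinverse. **Setting.** Let $n,m,T$ be natural numbers, $Q\in\mathbb R^{n\times n}$, $V\in\mathbb R^{m\times m}$, $\gamma\in\mathbb R$ (in the application $Q\succeq0$, $V\succ0$ is the square root of the input weight, $\gamma\ge0$). Let $D=[Z^{\sf T}\ X^{\sf T}\ U^{\sf T}]^{\sf T}$ with $Z,X\in\mathbb R^{n\times T}$, $U\in\mathbb R^{m\times T}$, and $\Gamma=[U^{\sf T}\ X^{\sf T}]^{\sf T}$, $\Pi=I_T-\Gamma^\dagger\Gamma$.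 Put $\hat n=3n+m$, $\bar n=2n+m$. For $L\in\mathbb R^{T\times n}$, $S\in\mathbb R^{m\times m}$, $\Lambda\in\mathbb R^{\hat n\times\hat n}$ let $$F_1=\begin{bmatrix}S&VUL\\(VUL)^{\sf T}&XL\end{bmatrix},\quad F_2=\begin{bmatrix}XL-I&ZL\\(ZL)^{\sf T}&XL\end{bmatrix},\quad F=\mathrm{diag}(F_1,F_2),$$ $$\mathcal L(L,S,\Lambda,D)=\mathrm{tr}(QXL)+\mathrm{tr}(S)+\gamma\|\Pi L\|_{\rm F}^2-\mathrm{tr}(F\Lambda^{\sf T}).$$ The components of the augmented KKT system are $G_1=\partial\mathcal L/\partial L\in\mathbb R^{1\times nT}$, $G_2=\partial\mathcal L/\partial S\in\mathbb R^{1\times m^2}$, $\bar G_3=F\Lambda^{\sf T}$, $G_4=\Lambda-\Lambda^{\sf T}$. Let $E_Z=[I_n\ 0\ 0]$, $E_X=[0\ I_n\ 0]$, $E_U=[0\ 0\ I_m]$ (so that $Z=E_ZD$, $X=E_XD$, $U=E_UD$), $E_i=\bar E_i\otimes\bar E_i$ with $\bar E_1=\begin{bmatrix}I_{n+m}\\0_{2n,n+m}\end{bmatrix}$,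 $\bar E_2=\begin{bmatrix}0_{n+m,2n}\\I_{2n}\end{bmatrix}$, and $C_1=I_n\otimes C_{T,m+n}\otimes I_{m+n}$, $C_2=I_n\otimes C_{T,2n}\otimes I_{2n}$, $\tilde C_1=I_T\otimes C_{n,m+n}\otimes I_{m+n}$, $\tilde C_2=I_T\otimes C_{n,2n}\otimes I_{2n}$. **Claim.** If $\Gamma$ has full row rank $m+n$, then at $(L,S,\Lambda,D)$ all the derivatives below exist, and the blocks are $$\frac{\partial G_1}{\partial L}=2\gamma(I_n\otimes\Pi),\quad\frac{\partial G_1}{\partial S}=0,\quad\frac{\partial G_1}{\partial\Lambda}=-\Big(\frac{\partial F}{\partial L}\Big)^{\sf T},$$ $$\frac{\partial G_1}{\partial D}=C_{n,T}(I_T\otimes(QE_X))+2\gamma(L^{\sf T}\otimes I_T)\frac{d\Pi}{dD}-(I_{nT}\otimes\mathrm{vec}(\Lambda)^{\sf T})\frac{\partial^2F}{\partial D\partial L},$$ $$\frac{\partial G_2}{\partial L}=0,\quad\frac{\partial G_2}{\partial S}=0,\quad\frac{\partial G_2}{\partial\Lambda}=-\Big(\frac{\partial F}{\partial S}\Big)^{\sf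 T},\quad\frac{\partial G_2}{\partial D}=-(I_{m^2}\otimes\mathrm{vec}(\Lambda)^{\sf T})\frac{\partial^2F}{\partial D\partial S},$$ $$\frac{\partial\bar G_3}{\partial L}=(\Lambda\otimes I_{\hat n})\frac{\partial F}{\partial L},\quad\frac{\partial\bar G_3}{\partial S}=(\Lambda\otimes I_{\hat n})\frac{\partial F}{\partial S},\quad\frac{\partial\bar G_3}{\partial\Lambda}=(I_{\hat n}\otimes F)C_{\hat n,\hat n},\quad\frac{\partial\bar G_3}{\partial D}=(\Lambda\otimes I_{\hat n})\frac{\partial F}{\partial D},$$ $$\frac{\partial G_4}{\partial L}=0,\quad\frac{\partial G_4}{\partial S}=0,\quad\frac{\partial G_4}{\partial\Lambda}=I_{\hat n^2}-C_{\hat n,\hat n},\quad\frac{\partial G_4}{\partial D}=0.$$ Here $\frac{\partial F}{\partial Y}=E_1\frac{\partial F_1}{\partial Y}+E_2\frac{\partial F_2}{\partial Y}$ for $Y\in\{L,S,D\}$, $\frac{\partial^2F}{\partial D\partial L}=(I_{nT}\otimes E_1)\frac{\partial^2F_1}{\partial D\partial L}+(I_{nT}\otimes E_2)\frac{\partial^2F_2}{\partial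 D\partial L}$, $\frac{\partial^2F}{\partial D\partial S}=0$, and, writing $[A;B]$ for $A$ stacked on $B$, $$\frac{\partial F_1}{\partial L}=[0;I_n]\otimes[VU;0]+([VU;0]\otimes[0;I_n])C_{T,n}+[0;I_n]\otimes[0_{m,T};X],$$ $$\frac{\partial F_2}{\partial L}=[I_n;0]\otimes[X;0]+[0;I_n]\otimes[Z;0]+([Z;0]\otimes[0;I_n])C_{T,n}+[0;I_n]\otimes[0;X],$$ $$\frac{\partial F_1}{\partial S}=[I_m;0]\otimes[I_m;0],\qquad\frac{\partial F_2}{\partial S}=0,$$ $$\frac{\partial F_1}{\partial D}=[0;L^{\sf T}]\otimes[VE_U;0]+([VE_U;0]\otimes[0;L^{\sf T}])C_{\bar n,T}+[0;L^{\sf T}]\otimes[0;E_X],$$ $$\frac{\partial F_2}{\partial D}=[L^{\sf T};0]\otimes[E_X;0]+[0;L^{\sf T}]\otimes[E_Z;0]+([E_Z;0]\otimes[0;L^{\sf T}])C_{\bar n,T}+[0;L^{\sf T}]\otimes[0;E_X],$$ $$\begin{aligned}\frac{\partial^2F_1}{\partial D\partial L}={}&C_1(\mathrm{vec}[0;I_n]\otimes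 I_{(m+n)T})(I_T\otimes[VE_U;0])+C_1(\mathrm{vec}[0;I_n]\otimes I_{(m+n)T})(I_T\otimes[0;E_X])\\&+(C_{T,n}^{\sf T}\otimes I_{(m+n)^2})\tilde C_1(I_{(m+n)T}\otimes\mathrm{vec}[0;I_n])(I_T\otimes[VE_U;0]),\end{aligned}$$ $$\begin{aligned}\frac{\partial^2F_2}{\partial D\partial L}={}&C_2(\mathrm{vec}[I_n;0]\otimes I_{2nT})(I_T\otimes[E_X;0])+C_2(\mathrm{vec}[0;I_n]\otimes I_{2nT})(I_T\otimes[E_Z;0])\\&+(C_{T,n}^{\sf T}\otimes I_{4n^2})\tilde C_2(I_{2nT}\otimes\mathrm{vec}[0;I_n])(I_T\otimes[E_Z;0])+C_2(\mathrm{vec}[0;I_n]\otimes I_{2nT})(I_T\otimes[0;E_X]).\end{aligned}$$ (The zero blocks and $[0;I_n]$ have $m+n$ rows in total in the formulas for $F_1$ and $2n$ rows in those for $F_2$.) Finally $$\frac{d\Pi}{dD}=\frac{\partial\Pi}{\partial X}(I_T\otimes E_X)+\frac{\partial\Pi}{\partial U}(I_T\otimes E_U),\qquad\frac{\partial\Gamma}{\partial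 X}=I_T\otimes[0_{m,n};I_n],\quad\frac{\partial\Gamma}{\partial U}=I_T\otimes[I_m;0_{n,m}],$$ $$\frac{\partial\Pi}{\partial Y}=-(\Gamma^{\sf T}\otimes I_T)\frac{d\Gamma^\dagger}{d\Gamma}\frac{\partial\Gamma}{\partial Y}-(I_T\otimes\Gamma^\dagger)\frac{\partial\Gamma}{\partial Y}\quad(Y\in\{X,U\}),$$ $$\frac{d\Gamma^\dagger}{d\Gamma}=((\Gamma\Gamma^{\sf T})^{-{\sf T}}\otimes I_T)C_{n+m,T}-(I_{m+n}\otimes\Gamma^{\sf T})\big((\Gamma\Gamma^{\sf T})^{-{\sf T}}\otimes(\Gamma\Gamma^{\sf T})^{-1}\big)\big((\Gamma\otimes I_{m+n})+(I_{m+n}\otimes\Gamma)C_{m+n,T}\big).$$ -/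

import Mathlib

open Matrix
open scoped Kronecker

noncomputable section

namespace DataDrivenLQR

/-! ### Matrix calculus: vectorization, commutation matrix, Jacobians -/

/-- The inverse of the column-stacking vectorization `Matrix.vec`. -/
def unvec {p q : Type*} (x : q × p → ℝ) : Matrix p q ℝ :=
  Matrix.of fun i j => x (j, i)

/-- The commutation matrix `C_{p,q}`, the matrix with `C_{p,q} vec(X) = vec(Xᵀ)` for all
`X ∈ ℝ^{p × q}`. -/
def commMat (p q : Type*) [DecidableEq p] [DecidableEq q] : Matrix (p × q) (q × p) ℝ :=
  Matrix.of fun a b => if a.1 = b.2 ∧ a.2 = b.1 then 1 else 0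

theorem commMat_mulVec_vec {p q : Type*} [Fintype p] [Fintype q] [DecidableEq p] [DecidableEq q]
    (X : Matrix p q ℝ) : commMat p q *ᵥ vec X = vec Xᵀ := by
  ext ⟨i, j⟩
  have h : ∀ b : q × p, (i = b.2 ∧ j = b.1) ↔ b = (j, i) := fun b => by
    constructor
    · rintro ⟨h1, h2⟩; ext <;> simp [h1, h2]
    · rintro rfl; simp
  simp [commMat, mulVec, dotProduct, h]

/-- `J` is the Jacobian at `X` of a (row or column) vector-valued function of the matrix variable
`X`: `f` is (Fréchet) differentiable at `X` and `J = d f / d vec(X)`. -/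
def HasVecJacobianAt {p q k : Type*} [Fintype p] [Fintype q] [Fintype k]
    (f : Matrix p q ℝ → k → ℝ) (J : Matrix k (q × p) ℝ) (X : Matrix p q ℝ) : Prop :=
  HasFDerivAt (fun x : q × p → ℝ => f (unvec x)) (LinearMap.toContinuousLinearMap J.mulVecLin)
    (vec X)

/-- `J` is the Jacobian `dF/dX = d vec(F) / d vec(X)` of a matrix-valued function at `X`. -/
def HasMatJacobianAt {p q r s : Type*} [Fintype p] [Fintype q] [Fintype r] [Fintype s]
    (f : Matrix p q ℝ → Matrix r s ℝ) (J : Matrix (s × r) (q × p) ℝ) (X : Matrix p q ℝ) : Prop :=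
  HasVecJacobianAt (fun Y => vec (f Y)) J X

/-- The Jacobian matrix of a vector-valued function of a matrix variable. -/
def vecJacobian {p q k : Type*} [Fintype p] [Fintype q] [DecidableEq p] [DecidableEq q] [Fintype k]
    (f : Matrix p q ℝ → k → ℝ) (X : Matrix p q ℝ) : Matrix k (q × p) ℝ :=
  LinearMap.toMatrix' (fderiv ℝ (fun x : q × p → ℝ => f (unvec x)) (vec X)).toLinearMap

/-- The Jacobian matrix `dF/dX = d vec(F) / d vec(X)` of a matrix-valued function. -/
def matJacobian {p q r s : Type*} [Fintype p] [Fintype q] [DecidableEq p] [DecidableEq q]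
    [Fintype r] [Fintype s] (f : Matrix p q ℝ → Matrix r s ℝ) (X : Matrix p q ℝ) :
    Matrix (s × r) (q × p) ℝ :=
  vecJacobian (fun Y => vec (f Y)) X

/-- The derivative `df/dX ∈ ℝ^{1 × pq}` of a scalar function, as a row vector. -/
def rowDeriv {p q : Type*} [Fintype p] [Fintype q] [DecidableEq p] [DecidableEq q]
    (f : Matrix p q ℝ → ℝ) (X : Matrix p q ℝ) : q × p → ℝ :=
  vecJacobian (fun Y (_ : Unit) => f Y) X ()

/-- `r` is the derivative `df/dX ∈ ℝ^{1 × pq}` of the scalar function `f`, differentiable at `X`. -/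
def HasRowDerivAt {p q : Type*} [Fintype p] [Fintype q]
    (f : Matrix p q ℝ → ℝ) (r : q × p → ℝ) (X : Matrix p q ℝ) : Prop :=
  HasVecJacobianAt (fun Y (_ : Unit) => f Y) (replicateRow Unit r) X

theorem HasVecJacobianAt.vecJacobian_eq {p q k : Type*} [Fintype p] [Fintype q] [DecidableEq p]
    [DecidableEq q] [Fintype k] {f : Matrix p q ℝ → k → ℝ} {J : Matrix k (q × p) ℝ}
    {X : Matrix p q ℝ} (h : HasVecJacobianAt f J X) : vecJacobian f X = J := by
  have h' := HasFDerivAt.fderiv h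
  unfold vecJacobian
  rw [h']
  exact LinearMap.toMatrix'_toLin' J

/-! ### Kronecker products with the index identifications written out -/

/-- `I_k ⊗ vᵀ` for a column vector `v`. -/
def eyeKronRow (k : Type*) {a : Type*} [DecidableEq k] (v : a → ℝ) : Matrix k (k × a) ℝ :=
  ((1 : Matrix k k ℝ) ⊗ₖ replicateRow Unit v).submatrix (fun i => (i, ())) id

/-- `v ⊗ I_k` for a column vector `v`. -/
def colKronEye (k : Type*) {a : Type*} [DecidableEq k] (v : a → ℝ) : Matrix (a × k) k ℝ :=
  (replicateCol Unit v ⊗ₖ (1 : Matrix k k ℝ)).submatrix id (fun j => ((), j))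

/-- `I_k ⊗ v` for a column vector `v`. -/
def eyeKronCol (k : Type*) {a : Type*} [DecidableEq k] (v : a → ℝ) : Matrix (k × a) k ℝ :=
  ((1 : Matrix k k ℝ) ⊗ₖ replicateCol Unit v).submatrix id (fun j => (j, ()))

/-- The associativity identification of the index sets of a triple Kronecker product. -/
def assoc4 (a b c d : Type*) : (a × (b × c)) × d ≃ (a × b) × (c × d) :=
  ((Equiv.prodAssoc a b c).symm.prodCongr (Equiv.refl d)).trans (Equiv.prodAssoc (a × b) c d)

/-- `I_a ⊗ C_{b,c} ⊗ I_d`. -/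
def eyeCommEye (a b c d : Type*) [DecidableEq a] [DecidableEq b] [DecidableEq c] [DecidableEq d] :
    Matrix ((a × b) × (c × d)) ((a × c) × (b × d)) ℝ :=
  Matrix.reindex (assoc4 a b c d) (assoc4 a c b d)
    (((1 : Matrix a a ℝ) ⊗ₖ commMat b c) ⊗ₖ (1 : Matrix d d ℝ))

/-! ### The Moore-Penrose pseudoinverse -/

/-- The four Moore-Penrose equations for real matrices. -/
structure IsMoorePenrose {p q : Type*} [Fintype p] [Fintype q]
    (A : Matrix p q ℝ) (B : Matrix q p ℝ) : Prop where
  mul_mul_self : A * B * A = A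
  self_mul_mul : B * A * B = B
  symm_left : (A * B)ᵀ = A * B
  symm_right : (B * A)ᵀ = B * A

theorem IsMoorePenrose.unique {p q : Type*} [Fintype p] [Fintype q]
    {A : Matrix p q ℝ} {B C : Matrix q p ℝ} (hB : IsMoorePenrose A B) (hC : IsMoorePenrose A C) :
    B = C := by
  have h1 : A * B = A * C := by
    calc A * B = (A * B)ᵀ := hB.symm_left.symm
      _ = ((A * C) * (A * B))ᵀ := by rw [← Matrix.mul_assoc (A * C), hC.mul_mul_self]
      _ = (A * B) * (A * C) := by rw [transpose_mul, hB.symm_left, hC.symm_left]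
      _ = A * C := by rw [← Matrix.mul_assoc, hB.mul_mul_self]
  have h2 : B * A = C * A := by
    calc B * A = (B * A)ᵀ := hB.symm_right.symm
      _ = ((B * A) * (C * A))ᵀ := by
        rw [Matrix.mul_assoc B A, ← Matrix.mul_assoc A C A, hC.mul_mul_self]
      _ = (C * A) * (B * A) := by rw [transpose_mul, hB.symm_right, hC.symm_right]
      _ = C * A := by rw [Matrix.mul_assoc C A, ← Matrix.mul_assoc A B A, hB.mul_mul_self]
  calc B = B * A * B := hB.self_mul_mul.symm
    _ = C * A * C := by rw [h2, Matrix.mul_assoc, h1, Matrix.mul_assoc]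
    _ = C := hC.self_mul_mul

theorem exists_isMoorePenrose_of_isHermitian {q : Type*} [Fintype q] [DecidableEq q]
    {H : Matrix q q ℝ} (hH : H.IsHermitian) : ∃ P : Matrix q q ℝ, IsMoorePenrose H P ∧ Pᵀ = P := by
  set U : Matrix q q ℝ := hH.eigenvectorUnitary.1 with hU
  set d : q → ℝ := hH.eigenvalues
  have hUU : Uᵀ * U = 1 := by
    have := Unitary.coe_star_mul_self hH.eigenvectorUnitary
    simpa [star_eq_conjTranspose] using this
  have hHd : H = U * diagonal d * Uᵀ := by
    have := hH.spectral_theorem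
    rw [Unitary.conjStarAlgAut_apply] at this
    simpa [star_eq_conjTranspose, Function.comp_def] using this
  have key : ∀ x y : q → ℝ, (U * diagonal x * Uᵀ) * (U * diagonal y * Uᵀ)
      = U * diagonal (fun i => x i * y i) * Uᵀ := by
    intro x y
    rw [← diagonal_mul_diagonal]
    calc (U * diagonal x * Uᵀ) * (U * diagonal y * Uᵀ)
        = U * diagonal x * (Uᵀ * U) * diagonal y * Uᵀ := by simp only [Matrix.mul_assoc]
      _ = U * (diagonal x * diagonal y) * Uᵀ := by rw [hUU]; simp only [Matrix.mul_assoc,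
            Matrix.mul_one]
  have sym : ∀ x : q → ℝ, (U * diagonal x * Uᵀ)ᵀ = U * diagonal x * Uᵀ := by
    intro x; simp only [transpose_mul, transpose_transpose, diagonal_transpose, Matrix.mul_assoc]
  refine ⟨U * diagonal (fun i => (d i)⁻¹) * Uᵀ, ⟨?_, ?_, ?_, ?_⟩, sym _⟩
  · rw [hHd, key, key]
    congr 3
    funext i
    exact mul_inv_mul_cancel (d i)
  · rw [hHd, key, key]
    congr 3
    funext i
    simpa using mul_inv_mul_cancel (d i)⁻¹
  · rw [hHd, key, sym]
  · rw [hHd, key, sym]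

theorem exists_isMoorePenrose {p q : Type*} [Fintype p] [Fintype q]
    (A : Matrix p q ℝ) : ∃ B : Matrix q p ℝ, IsMoorePenrose A B := by
  classical
  have hH : (Aᵀ * A).IsHermitian := by
    simpa only [conjTranspose_eq_transpose_of_trivial] using isHermitian_conjTranspose_mul_self A
  obtain ⟨P, hP, hPs⟩ := exists_isMoorePenrose_of_isHermitian hH
  have hA : A * (P * (Aᵀ * A)) = A := by
    have h0 : (A - A * (P * (Aᵀ * A)))ᵀ * (A - A * (P * (Aᵀ * A))) = 0 := by
      have e : Aᵀ * (A - A * (P * (Aᵀ * A))) = 0 := by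
        rw [Matrix.mul_sub, ← Matrix.mul_assoc, ← Matrix.mul_assoc (Aᵀ * A), hP.mul_mul_self,
          sub_self]
      have e2 : A - A * (P * (Aᵀ * A)) = A * (1 - P * (Aᵀ * A)) := by
        rw [Matrix.mul_sub, Matrix.mul_one]
      conv_lhs => rw [e2, transpose_mul, ← e2, Matrix.mul_assoc, e, Matrix.mul_zero]
    have h1 : A - A * (P * (Aᵀ * A)) = 0 := by
      rw [← conjTranspose_mul_self_eq_zero]; simpa using h0
    exact (sub_eq_zero.mp h1).symm
  refine ⟨P * Aᵀ, ?_, ?_, ?_, ?_⟩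
  · simpa only [Matrix.mul_assoc] using hA
  · calc P * Aᵀ * A * (P * Aᵀ) = P * (Aᵀ * A) * P * Aᵀ := by simp only [Matrix.mul_assoc]
      _ = P * Aᵀ := by rw [hP.self_mul_mul]
  · simp [transpose_mul, hPs, Matrix.mul_assoc]
  · simpa only [Matrix.mul_assoc] using hP.symm_right

/-- The Moore-Penrose pseudoinverse `A†` of a real matrix. -/
def pinv {p q : Type*} [Fintype p] [Fintype q] (A : Matrix p q ℝ) : Matrix q p ℝ :=
  Classical.choose (exists_isMoorePenrose A)

theorem pinv_spec {p q : Type*} [Fintype p] [Fintype q] (A : Matrix p q ℝ) :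
    IsMoorePenrose A (pinv A) :=
  Classical.choose_spec (exists_isMoorePenrose A)

/-! ### The data-driven LQR problem

The data is `D = [Z; X; U]` with `Z, X ∈ ℝ^{n × T}` and `U ∈ ℝ^{m × T}`. -/

/-- The row index set of `D`, with `n + n + m` elements. -/
abbrev DIdx (n m : ℕ) := Fin n ⊕ (Fin n ⊕ Fin m)

/-- The index set of `F₁`, and the row index set of `Γ`, with `m + n` elements. -/
abbrev Idx1 (n m : ℕ) := Fin m ⊕ Fin n

/-- The index set of `F₂`, with `2n` elements. -/
abbrev Idx2 (n : ℕ) := Fin n ⊕ Fin n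

/-- The index set of `F` and `Λ`, with `(m + n) + 2n` elements. -/
abbrev FIdx (n m : ℕ) := Idx1 n m ⊕ Idx2 n

variable {n m T : ℕ}

def dataZ (D : Matrix (DIdx n m) (Fin T) ℝ) : Matrix (Fin n) (Fin T) ℝ := D.toRows₁

def dataX (D : Matrix (DIdx n m) (Fin T) ℝ) : Matrix (Fin n) (Fin T) ℝ := D.toRows₂.toRows₁

def dataU (D : Matrix (DIdx n m) (Fin T) ℝ) : Matrix (Fin m) (Fin T) ℝ := D.toRows₂.toRows₂

/-- `Γ = [U; X]`. -/
def Gam (X : Matrix (Fin n) (Fin T) ℝ) (U : Matrix (Fin m) (Fin T) ℝ) :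
    Matrix (Idx1 n m) (Fin T) ℝ :=
  fromRows U X

/-- `Γ` as a function of the data. -/
def GamD (D : Matrix (DIdx n m) (Fin T) ℝ) : Matrix (Idx1 n m) (Fin T) ℝ :=
  Gam (dataX D) (dataU D)

/-- `Π = I - Γ† Γ`. -/
def Proj (Γ : Matrix (Idx1 n m) (Fin T) ℝ) : Matrix (Fin T) (Fin T) ℝ :=
  1 - pinv Γ * Γ

/-- The squared Frobenius norm. -/
def frobSq {p q : Type*} [Fintype p] [Fintype q] (M : Matrix p q ℝ) : ℝ :=
  ∑ i, ∑ j, M i j ^ 2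

/-- The objective `J = tr(QXL) + tr(S) + γ ‖ΠL‖_F²`. -/
def obj (Q : Matrix (Fin n) (Fin n) ℝ) (γ : ℝ) (L : Matrix (Fin T) (Fin n) ℝ)
    (S : Matrix (Fin m) (Fin m) ℝ) (D : Matrix (DIdx n m) (Fin T) ℝ) : ℝ :=
  (Q * dataX D * L).trace + S.trace + γ * frobSq (Proj (GamD D) * L)

/-- `F₁ = [S, VUL; (VUL)ᵀ, XL]`. -/
def F1 (V : Matrix (Fin m) (Fin m) ℝ) (L : Matrix (Fin T) (Fin n) ℝ)
    (S : Matrix (Fin m) (Fin m) ℝ) (D : Matrix (DIdx n m) (Fin T) ℝ) :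
    Matrix (Idx1 n m) (Idx1 n m) ℝ :=
  fromBlocks S (V * dataU D * L) (V * dataU D * L)ᵀ (dataX D * L)

/-- `F₂ = [XL - I, ZL; (ZL)ᵀ, XL]`. -/
def F2 (L : Matrix (Fin T) (Fin n) ℝ) (D : Matrix (DIdx n m) (Fin T) ℝ) :
    Matrix (Idx2 n) (Idx2 n) ℝ :=
  fromBlocks (dataX D * L - 1) (dataZ D * L) (dataZ D * L)ᵀ (dataX D * L)

/-- `F = diag(F₁, F₂)`. -/
def F (V : Matrix (Fin m) (Fin m) ℝ) (L : Matrix (Fin T) (Fin n) ℝ)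
    (S : Matrix (Fin m) (Fin m) ℝ) (D : Matrix (DIdx n m) (Fin T) ℝ) :
    Matrix (FIdx n m) (FIdx n m) ℝ :=
  fromBlocks (F1 V L S D) 0 0 (F2 L D)

/-- The Lagrangian `J - tr(F Λᵀ)`. -/
def lagr (Q : Matrix (Fin n) (Fin n) ℝ) (V : Matrix (Fin m) (Fin m) ℝ) (γ : ℝ)
    (L : Matrix (Fin T) (Fin n) ℝ) (S : Matrix (Fin m) (Fin m) ℝ)
    (Λ : Matrix (FIdx n m) (FIdx n m) ℝ) (D : Matrix (DIdx n m) (Fin T) ℝ) : ℝ :=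
  obj Q γ L S D - (F V L S D * Λᵀ).trace

/-! ### The four components of the augmented KKT system -/

/-- `G₁ = ∂ℒ/∂L ∈ ℝ^{1 × nT}`. -/
def G1 (Q : Matrix (Fin n) (Fin n) ℝ) (V : Matrix (Fin m) (Fin m) ℝ) (γ : ℝ)
    (L : Matrix (Fin T) (Fin n) ℝ) (S : Matrix (Fin m) (Fin m) ℝ)
    (Λ : Matrix (FIdx n m) (FIdx n m) ℝ) (D : Matrix (DIdx n m) (Fin T) ℝ) : Fin n × Fin T → ℝ :=
  rowDeriv (fun L' => lagr Q V γ L' S Λ D) L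

/-- `G₂ = ∂ℒ/∂S ∈ ℝ^{1 × m²}`. -/
def G2 (Q : Matrix (Fin n) (Fin n) ℝ) (V : Matrix (Fin m) (Fin m) ℝ) (γ : ℝ)
    (L : Matrix (Fin T) (Fin n) ℝ) (S : Matrix (Fin m) (Fin m) ℝ)
    (Λ : Matrix (FIdx n m) (FIdx n m) ℝ) (D : Matrix (DIdx n m) (Fin T) ℝ) : Fin m × Fin m → ℝ :=
  rowDeriv (fun S' => lagr Q V γ L S' Λ D) S

/-- `G₃ = F Λᵀ`, the matrix form of complementarity. -/
def G3 (V : Matrix (Fin m) (Fin m) ℝ) (L : Matrix (Fin T) (Fin n) ℝ)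
    (S : Matrix (Fin m) (Fin m) ℝ) (Λ : Matrix (FIdx n m) (FIdx n m) ℝ)
    (D : Matrix (DIdx n m) (Fin T) ℝ) : Matrix (FIdx n m) (FIdx n m) ℝ :=
  F V L S D * Λᵀ

/-- `G₄ = Λ - Λᵀ`. -/
def G4 (Λ : Matrix (FIdx n m) (FIdx n m) ℝ) : Matrix (FIdx n m) (FIdx n m) ℝ :=
  Λ - Λᵀ

/-! ### Constant selection matrices -/

/-- `E_Z = [I_n 0 0]`. -/
def EZ (n m : ℕ) : Matrix (Fin n) (DIdx n m) ℝ := fromCols 1 0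

/-- `E_X = [0 I_n 0]`. -/
def EX (n m : ℕ) : Matrix (Fin n) (DIdx n m) ℝ := fromCols 0 (fromCols 1 0)

/-- `E_U = [0 0 I_m]`. -/
def EU (n m : ℕ) : Matrix (Fin m) (DIdx n m) ℝ := fromCols 0 (fromCols 0 1)

/-- `Ē₁ = [I_{n+m}; 0]`. -/
def E1bar (n m : ℕ) : Matrix (FIdx n m) (Idx1 n m) ℝ := fromRows 1 0

/-- `Ē₂ = [0; I_{2n}]`. -/
def E2bar (n m : ℕ) : Matrix (FIdx n m) (Idx2 n) ℝ := fromRows 0 1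

/-- `E₁ = Ē₁ ⊗ Ē₁`. -/
def E1 (n m : ℕ) : Matrix (FIdx n m × FIdx n m) (Idx1 n m × Idx1 n m) ℝ :=
  E1bar n m ⊗ₖ E1bar n m

/-- `E₂ = Ē₂ ⊗ Ē₂`. -/
def E2 (n m : ℕ) : Matrix (FIdx n m × FIdx n m) (Idx2 n × Idx2 n) ℝ :=
  E2bar n m ⊗ₖ E2bar n m

/-- `[0_{m,n}; I_n]`. -/
def low1 (n m : ℕ) : Matrix (Idx1 n m) (Fin n) ℝ := fromRows 0 1

/-- `[I_m; 0_{n,m}]`. -/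
def up1 (n m : ℕ) : Matrix (Idx1 n m) (Fin m) ℝ := fromRows 1 0

/-- `[0_{n,n}; I_n]`. -/
def low2 (n : ℕ) : Matrix (Idx2 n) (Fin n) ℝ := fromRows 0 1

/-- `[I_n; 0_{n,n}]`. -/
def up2 (n : ℕ) : Matrix (Idx2 n) (Fin n) ℝ := fromRows 1 0

/-! ### Closed-form expressions of the derivatives -/

/-- Closed form of `∂F₁/∂L`. -/
def dF1dL (V : Matrix (Fin m) (Fin m) ℝ) (D : Matrix (DIdx n m) (Fin T) ℝ) :
    Matrix (Idx1 n m × Idx1 n m) (Fin n × Fin T) ℝ :=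
  low1 n m ⊗ₖ fromRows (V * dataU D) (0 : Matrix (Fin n) (Fin T) ℝ)
    + (fromRows (V * dataU D) (0 : Matrix (Fin n) (Fin T) ℝ) ⊗ₖ low1 n m) * commMat (Fin T) (Fin n)
    + low1 n m ⊗ₖ fromRows (0 : Matrix (Fin m) (Fin T) ℝ) (dataX D)

/-- Closed form of `∂F₂/∂L`. -/
def dF2dL (D : Matrix (DIdx n m) (Fin T) ℝ) :
    Matrix (Idx2 n × Idx2 n) (Fin n × Fin T) ℝ :=
  up2 n ⊗ₖ fromRows (dataX D) (0 : Matrix (Fin n) (Fin T) ℝ)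
    + low2 n ⊗ₖ fromRows (dataZ D) (0 : Matrix (Fin n) (Fin T) ℝ)
    + (fromRows (dataZ D) (0 : Matrix (Fin n) (Fin T) ℝ) ⊗ₖ low2 n) * commMat (Fin T) (Fin n)
    + low2 n ⊗ₖ fromRows (0 : Matrix (Fin n) (Fin T) ℝ) (dataX D)

/-- Closed form of `∂F/∂L`. -/
def dFdL (V : Matrix (Fin m) (Fin m) ℝ) (D : Matrix (DIdx n m) (Fin T) ℝ) :
    Matrix (FIdx n m × FIdx n m) (Fin n × Fin T) ℝ :=
  E1 n m * dF1dL V D + E2 n m * dF2dL D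

/-- Closed form of `∂F₁/∂S`. -/
def dF1dS (n m : ℕ) : Matrix (Idx1 n m × Idx1 n m) (Fin m × Fin m) ℝ :=
  up1 n m ⊗ₖ up1 n m

/-- Closed form of `∂F₂/∂S`. -/
def dF2dS (n m : ℕ) : Matrix (Idx2 n × Idx2 n) (Fin m × Fin m) ℝ := 0

/-- Closed form of `∂F/∂S`. -/
def dFdS (n m : ℕ) : Matrix (FIdx n m × FIdx n m) (Fin m × Fin m) ℝ :=
  E1 n m * dF1dS n m + E2 n m * dF2dS n m

/-- `[V E_U; 0]`. -/
def VEU (V : Matrix (Fin m) (Fin m) ℝ) : Matrix (Idx1 n m) (DIdx n m) ℝ :=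
  fromRows (V * EU n m) 0

/-- `[0; E_X]` with `m` zero rows. -/
def lowEX1 (n m : ℕ) : Matrix (Idx1 n m) (DIdx n m) ℝ := fromRows 0 (EX n m)

/-- `[E_X; 0]` with `n` zero rows. -/
def upEX2 (n m : ℕ) : Matrix (Idx2 n) (DIdx n m) ℝ := fromRows (EX n m) 0

/-- `[E_Z; 0]` with `n` zero rows. -/
def upEZ2 (n m : ℕ) : Matrix (Idx2 n) (DIdx n m) ℝ := fromRows (EZ n m) 0

/-- `[0; E_X]` with `n` zero rows. -/
def lowEX2 (n m : ℕ) : Matrix (Idx2 n) (DIdx n m) ℝ := fromRows 0 (EX n m)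

/-- Closed form of `∂F₁/∂D`. -/
def dF1dD (V : Matrix (Fin m) (Fin m) ℝ) (L : Matrix (Fin T) (Fin n) ℝ) :
    Matrix (Idx1 n m × Idx1 n m) (Fin T × DIdx n m) ℝ :=
  fromRows (0 : Matrix (Fin m) (Fin T) ℝ) Lᵀ ⊗ₖ VEU V
    + (VEU V ⊗ₖ fromRows (0 : Matrix (Fin m) (Fin T) ℝ) Lᵀ) * commMat (DIdx n m) (Fin T)
    + fromRows (0 : Matrix (Fin m) (Fin T) ℝ) Lᵀ ⊗ₖ lowEX1 n m

/-- Closed form of `∂F₂/∂D`. -/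
def dF2dD (m : ℕ) (L : Matrix (Fin T) (Fin n) ℝ) :
    Matrix (Idx2 n × Idx2 n) (Fin T × DIdx n m) ℝ :=
  fromRows Lᵀ (0 : Matrix (Fin n) (Fin T) ℝ) ⊗ₖ upEX2 n m
    + fromRows (0 : Matrix (Fin n) (Fin T) ℝ) Lᵀ ⊗ₖ upEZ2 n m
    + (upEZ2 n m ⊗ₖ fromRows (0 : Matrix (Fin n) (Fin T) ℝ) Lᵀ) * commMat (DIdx n m) (Fin T)
    + fromRows (0 : Matrix (Fin n) (Fin T) ℝ) Lᵀ ⊗ₖ lowEX2 n m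

/-- Closed form of `∂F/∂D`. -/
def dFdD (V : Matrix (Fin m) (Fin m) ℝ) (L : Matrix (Fin T) (Fin n) ℝ) :
    Matrix (FIdx n m × FIdx n m) (Fin T × DIdx n m) ℝ :=
  E1 n m * dF1dD V L + E2 n m * dF2dD m L

/-- `C₁ = I_n ⊗ C_{T,m+n} ⊗ I_{m+n}`. -/
def C1 (n m T : ℕ) : Matrix ((Fin n × Fin T) × (Idx1 n m × Idx1 n m))
    ((Fin n × Idx1 n m) × (Fin T × Idx1 n m)) ℝ :=
  eyeCommEye (Fin n) (Fin T) (Idx1 n m) (Idx1 n m)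

/-- `C₂ = I_n ⊗ C_{T,2n} ⊗ I_{2n}`. -/
def C2 (n T : ℕ) : Matrix ((Fin n × Fin T) × (Idx2 n × Idx2 n))
    ((Fin n × Idx2 n) × (Fin T × Idx2 n)) ℝ :=
  eyeCommEye (Fin n) (Fin T) (Idx2 n) (Idx2 n)

/-- `C̃₁ = I_T ⊗ C_{n,m+n} ⊗ I_{m+n}`. -/
def C1t (n m T : ℕ) : Matrix ((Fin T × Fin n) × (Idx1 n m × Idx1 n m))
    ((Fin T × Idx1 n m) × (Fin n × Idx1 n m)) ℝ :=
  eyeCommEye (Fin T) (Fin n) (Idx1 n m) (Idx1 n m)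

/-- `C̃₂ = I_T ⊗ C_{n,2n} ⊗ I_{2n}`. -/
def C2t (n T : ℕ) : Matrix ((Fin T × Fin n) × (Idx2 n × Idx2 n))
    ((Fin T × Idx2 n) × (Fin n × Idx2 n)) ℝ :=
  eyeCommEye (Fin T) (Fin n) (Idx2 n) (Idx2 n)

/-- Closed form of `∂²F₁/∂D∂L`, the Jacobian with respect to `D` of the matrix `∂F₁/∂L`. -/
def d2F1dDdL (T : ℕ) (V : Matrix (Fin m) (Fin m) ℝ) :
    Matrix ((Fin n × Fin T) × (Idx1 n m × Idx1 n m)) (Fin T × DIdx n m) ℝ :=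
  C1 n m T * colKronEye (Fin T × Idx1 n m) (vec (low1 n m))
      * ((1 : Matrix (Fin T) (Fin T) ℝ) ⊗ₖ VEU V)
    + C1 n m T * colKronEye (Fin T × Idx1 n m) (vec (low1 n m))
      * ((1 : Matrix (Fin T) (Fin T) ℝ) ⊗ₖ lowEX1 n m)
    + ((commMat (Fin T) (Fin n))ᵀ ⊗ₖ (1 : Matrix (Idx1 n m × Idx1 n m) (Idx1 n m × Idx1 n m) ℝ))
      * C1t n m T * eyeKronCol (Fin T × Idx1 n m) (vec (low1 n m))
      * ((1 : Matrix (Fin T) (Fin T) ℝ) ⊗ₖ VEU V)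

/-- Closed form of `∂²F₂/∂D∂L`, the Jacobian with respect to `D` of the matrix `∂F₂/∂L`. -/
def d2F2dDdL (n m T : ℕ) :
    Matrix ((Fin n × Fin T) × (Idx2 n × Idx2 n)) (Fin T × DIdx n m) ℝ :=
  C2 n T * colKronEye (Fin T × Idx2 n) (vec (up2 n))
      * ((1 : Matrix (Fin T) (Fin T) ℝ) ⊗ₖ upEX2 n m)
    + C2 n T * colKronEye (Fin T × Idx2 n) (vec (low2 n))
      * ((1 : Matrix (Fin T) (Fin T) ℝ) ⊗ₖ upEZ2 n m)
    + ((commMat (Fin T) (Fin n))ᵀ ⊗ₖ (1 : Matrix (Idx2 n × Idx2 n) (Idx2 n × Idx2 n) ℝ))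
      * C2t n T * eyeKronCol (Fin T × Idx2 n) (vec (low2 n))
      * ((1 : Matrix (Fin T) (Fin T) ℝ) ⊗ₖ upEZ2 n m)
    + C2 n T * colKronEye (Fin T × Idx2 n) (vec (low2 n))
      * ((1 : Matrix (Fin T) (Fin T) ℝ) ⊗ₖ lowEX2 n m)

/-- Closed form of `∂²F/∂D∂L`. -/
def d2FdDdL (T : ℕ) (V : Matrix (Fin m) (Fin m) ℝ) :
    Matrix ((Fin n × Fin T) × (FIdx n m × FIdx n m)) (Fin T × DIdx n m) ℝ :=
  ((1 : Matrix (Fin n × Fin T) (Fin n × Fin T) ℝ) ⊗ₖ E1 n m) * d2F1dDdL T V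
    + ((1 : Matrix (Fin n × Fin T) (Fin n × Fin T) ℝ) ⊗ₖ E2 n m) * d2F2dDdL n m T

/-- Closed form of `∂Γ/∂X`. -/
def dGamdX (n m T : ℕ) : Matrix (Fin T × Idx1 n m) (Fin T × Fin n) ℝ :=
  (1 : Matrix (Fin T) (Fin T) ℝ) ⊗ₖ low1 n m

/-- Closed form of `∂Γ/∂U`. -/
def dGamdU (n m T : ℕ) : Matrix (Fin T × Idx1 n m) (Fin T × Fin m) ℝ :=
  (1 : Matrix (Fin T) (Fin T) ℝ) ⊗ₖ up1 n m

/-- Closed form of `dΓ†/dΓ`. -/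
def dPinv (Γ : Matrix (Idx1 n m) (Fin T) ℝ) :
    Matrix (Idx1 n m × Fin T) (Fin T × Idx1 n m) ℝ :=
  (((Γ * Γᵀ)⁻¹)ᵀ ⊗ₖ (1 : Matrix (Fin T) (Fin T) ℝ)) * commMat (Idx1 n m) (Fin T)
    - ((1 : Matrix (Idx1 n m) (Idx1 n m) ℝ) ⊗ₖ Γᵀ) * (((Γ * Γᵀ)⁻¹)ᵀ ⊗ₖ (Γ * Γᵀ)⁻¹)
      * (Γ ⊗ₖ (1 : Matrix (Idx1 n m) (Idx1 n m) ℝ)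
        + ((1 : Matrix (Idx1 n m) (Idx1 n m) ℝ) ⊗ₖ Γ) * commMat (Idx1 n m) (Fin T))

/-- Closed form of `dΠ/dX`. -/
def dProjdX (Γ : Matrix (Idx1 n m) (Fin T) ℝ) : Matrix (Fin T × Fin T) (Fin T × Fin n) ℝ :=
  -((Γᵀ ⊗ₖ (1 : Matrix (Fin T) (Fin T) ℝ)) * dPinv Γ * dGamdX n m T)
    - ((1 : Matrix (Fin T) (Fin T) ℝ) ⊗ₖ pinv Γ) * dGamdX n m T

/-- Closed form of `dΠ/dU`. -/
def dProjdU (Γ : Matrix (Idx1 n m) (Fin T) ℝ) : Matrix (Fin T × Fin T) (Fin T × Fin m) ℝ :=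
  -((Γᵀ ⊗ₖ (1 : Matrix (Fin T) (Fin T) ℝ)) * dPinv Γ * dGamdU n m T)
    - ((1 : Matrix (Fin T) (Fin T) ℝ) ⊗ₖ pinv Γ) * dGamdU n m T

/-- Closed form of `dΠ/dD`. -/
def dProjdD (Γ : Matrix (Idx1 n m) (Fin T) ℝ) : Matrix (Fin T × Fin T) (Fin T × DIdx n m) ℝ :=
  dProjdX Γ * ((1 : Matrix (Fin T) (Fin T) ℝ) ⊗ₖ EX n m)
    + dProjdU Γ * ((1 : Matrix (Fin T) (Fin T) ℝ) ⊗ₖ EU n m)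

end DataDrivenLQR

end

open DataDrivenLQR

open Matrix
open scoped Kronecker

noncomputable section

namespace DataDrivenLQR

/-! ### Rules of calculus for Jacobians -/

/-! Two identities drive every formula: vec(A M B) = (Bᵀ ⊗ A) vec(M) and vec(Mᵀ) = C vec(M). They
turn a matrix expression that is affine in one variable into "coefficient matrix times vec, plus a
constant", and that coefficient matrix is the Jacobian (`hasMatJacobianAt_of_affine`). The blocks
F₁, F₂, F, the products F Λᵀ and Λ - Λᵀ are affine in each argument separately, so their Jacobians
are read off this way.

The matrix ∂F/∂L is in turn linear in D, being a sum of Kronecker products with one factor constant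
and the other linear in D. Its Jacobian comes from writing vec(A ⊗ B) as a permutation of vec(A) ⊗
vec(B) (`vec_kronecker_eq_colKronEye`, `vec_kronecker_eq_eyeKronCol`).

For G₁ and G₂, the trace terms of the Lagrangian are pairings of vec's, and the gradient of γ‖ΠL‖²
is 2γ ΠᵀΠL = 2γ ΠL because Π is a symmetric idempotent. This needs no rank condition, so `G1_eq` and
`G2_eq` are closed forms at all arguments and can be differentiated once more.

The only nonlinear dependence left is that of Π on D. Full row rank makes ΓΓᵀ invertible, and this
persists near Γ; there Γ† = Γᵀ(ΓΓᵀ)⁻¹, and the product and inverse rules give dΓ†/dΓ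
(`hasMatJacobianAt_pinv`). The chain rule along D ↦ Γ ↦ Π then yields dΠ/dD and, with it, ∂G₁/∂D. -/

theorem unvec_vec {p q : Type*} (X : Matrix p q ℝ) : unvec (vec X) = X := rfl

theorem vec_unvec {p q : Type*} (x : q × p → ℝ) : vec (unvec x) = x := rfl

theorem continuous_unvec {p q : Type*} :
    Continuous (unvec : (q × p → ℝ) → Matrix p q ℝ) :=
  continuous_matrix fun i j => continuous_apply (j, i)

/-- Every vector is the vec of some matrix H. Testing two Jacobians on directions vec(H) replaces
Kronecker and commutation algebra by ordinary matrix products. -/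
theorem eq_of_forall_mulVec_vec {p q k : Type*} [Fintype p] [Fintype q] {A B : Matrix k (q × p) ℝ}
    (h : ∀ H : Matrix p q ℝ, A *ᵥ vec H = B *ᵥ vec H) : A = B := by
  classical
  exact Matrix.mulVec_injective (funext fun x => h (unvec x))

section Calculus

variable {p q r s t k l : Type*} [Fintype p] [Fintype q] [Fintype r] [Fintype s] [Fintype t]
  [Fintype k] [Fintype l]

theorem HasVecJacobianAt.hasFDerivAt {f : Matrix p q ℝ → k → ℝ} {J : Matrix k (q × p) ℝ}
    {X : Matrix p q ℝ} (h : HasVecJacobianAt f J X) :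
    HasFDerivAt (fun x : q × p → ℝ => f (unvec x))
      (LinearMap.toContinuousLinearMap J.mulVecLin) (vec X) := h

theorem HasVecJacobianAt.congr_jacobian {f : Matrix p q ℝ → k → ℝ} {J J' : Matrix k (q × p) ℝ}
    {X : Matrix p q ℝ} (h : HasVecJacobianAt f J X) (e : J = J') : HasVecJacobianAt f J' X :=
  e ▸ h

theorem HasMatJacobianAt.matJacobian_eq [DecidableEq p] [DecidableEq q]
    {f : Matrix p q ℝ → Matrix r s ℝ} {J : Matrix (s × r) (q × p) ℝ}
    {X : Matrix p q ℝ} (h : HasMatJacobianAt f J X) : matJacobian f X = J :=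
  HasVecJacobianAt.vecJacobian_eq h

theorem HasRowDerivAt.rowDeriv_eq [DecidableEq p] [DecidableEq q]
    {f : Matrix p q ℝ → ℝ} {v : q × p → ℝ} {X : Matrix p q ℝ} (h : HasRowDerivAt f v X) :
    rowDeriv f X = v := by
  have := HasVecJacobianAt.vecJacobian_eq h
  unfold rowDeriv
  rw [this]
  rfl

/-- An affine map is its own first-order expansion, so differentiability and the Jacobian both
follow from one algebraic identity. -/
theorem hasVecJacobianAt_of_affine {f : Matrix p q ℝ → k → ℝ} (J : Matrix k (q × p) ℝ)
    (c : k → ℝ) (h : ∀ Y, f Y = J *ᵥ vec Y + c) (X : Matrix p q ℝ) : HasVecJacobianAt f J X := by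
  have h1 : (fun x : q × p → ℝ => f (unvec x))
      = fun x => LinearMap.toContinuousLinearMap J.mulVecLin x + c := by
    funext x
    rw [h, vec_unvec]
    rfl
  unfold HasVecJacobianAt
  rw [h1]
  exact (ContinuousLinearMap.hasFDerivAt _).add_const c

theorem hasMatJacobianAt_of_affine {f : Matrix p q ℝ → Matrix r s ℝ} (J : Matrix (s × r) (q × p) ℝ)
    (C : Matrix r s ℝ) (h : ∀ Y, vec (f Y) = J *ᵥ vec Y + vec C) (X : Matrix p q ℝ) :
    HasMatJacobianAt f J X :=
  hasVecJacobianAt_of_affine J (vec C) h X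

theorem hasVecJacobianAt_const (c : k → ℝ) (X : Matrix p q ℝ) :
    HasVecJacobianAt (fun _ => c) 0 X :=
  hasVecJacobianAt_of_affine 0 c (fun Y => by simp) X

theorem hasMatJacobianAt_const (C : Matrix r s ℝ) (X : Matrix p q ℝ) :
    HasMatJacobianAt (fun _ => C) 0 X :=
  hasVecJacobianAt_const (vec C) X

theorem hasMatJacobianAt_id [DecidableEq p] [DecidableEq q] (X : Matrix p q ℝ) :
    HasMatJacobianAt (fun Y => Y) 1 X :=
  hasMatJacobianAt_of_affine 1 0 (fun Y => by simp) X

theorem HasVecJacobianAt.add {f g : Matrix p q ℝ → k → ℝ} {J K : Matrix k (q × p) ℝ}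
    {X : Matrix p q ℝ} (hf : HasVecJacobianAt f J X) (hg : HasVecJacobianAt g K X) :
    HasVecJacobianAt (fun Y => f Y + g Y) (J + K) X := by
  refine (hf.hasFDerivAt.add hg.hasFDerivAt).congr_fderiv ?_
  ext1 x
  simp

theorem HasVecJacobianAt.mulVec {f : Matrix p q ℝ → k → ℝ} {J : Matrix k (q × p) ℝ}
    {X : Matrix p q ℝ} (A : Matrix l k ℝ) (hf : HasVecJacobianAt f J X) :
    HasVecJacobianAt (fun Y => A *ᵥ f Y) (A * J) X := by
  refine ((LinearMap.toContinuousLinearMap A.mulVecLin).hasFDerivAt.comp (vec X)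
    hf.hasFDerivAt).congr_fderiv ?_
  ext1 x
  simp [mulVec_mulVec]

theorem HasVecJacobianAt.const_smul {f : Matrix p q ℝ → k → ℝ} {J : Matrix k (q × p) ℝ}
    {X : Matrix p q ℝ} (c : ℝ) (hf : HasVecJacobianAt f J X) :
    HasVecJacobianAt (fun Y => c • f Y) (c • J) X := by
  refine (hf.hasFDerivAt.const_smul c).congr_fderiv ?_
  ext1 x
  simp

theorem HasVecJacobianAt.neg {f : Matrix p q ℝ → k → ℝ} {J : Matrix k (q × p) ℝ}
    {X : Matrix p q ℝ} (hf : HasVecJacobianAt f J X) : HasVecJacobianAt (fun Y => -f Y) (-J) X := by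
  simpa using hf.const_smul (-1)

theorem HasVecJacobianAt.sub {f g : Matrix p q ℝ → k → ℝ} {J K : Matrix k (q × p) ℝ}
    {X : Matrix p q ℝ} (hf : HasVecJacobianAt f J X) (hg : HasVecJacobianAt g K X) :
    HasVecJacobianAt (fun Y => f Y - g Y) (J - K) X := by
  simpa [sub_eq_add_neg] using hf.add hg.neg

theorem HasVecJacobianAt.comp {g : Matrix r s ℝ → k → ℝ} {f : Matrix p q ℝ → Matrix r s ℝ}
    {K : Matrix k (s × r) ℝ} {J : Matrix (s × r) (q × p) ℝ} (X : Matrix p q ℝ)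
    (hg : HasVecJacobianAt g K (f X)) (hf : HasMatJacobianAt f J X) :
    HasVecJacobianAt (fun Y => g (f Y)) (K * J) X := by
  have h := HasFDerivAt.comp (f := fun x : q × p → ℝ => vec (f (unvec x)))
    (g := fun y : s × r → ℝ => g (unvec y)) (vec X) hg hf
  refine h.congr_fderiv ?_
  ext1 x
  simp [mulVec_mulVec]

theorem HasMatJacobianAt.comp {g : Matrix r s ℝ → Matrix k l ℝ} {f : Matrix p q ℝ → Matrix r s ℝ}
    {K : Matrix (l × k) (s × r) ℝ} {J : Matrix (s × r) (q × p) ℝ} (X : Matrix p q ℝ)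
    (hg : HasMatJacobianAt g K (f X)) (hf : HasMatJacobianAt f J X) :
    HasMatJacobianAt (fun Y => g (f Y)) (K * J) X :=
  HasVecJacobianAt.comp X hg hf

theorem HasVecJacobianAt.congr_of_eventuallyEq {f g : Matrix p q ℝ → k → ℝ}
    {J : Matrix k (q × p) ℝ} {X : Matrix p q ℝ} (hf : HasVecJacobianAt f J X)
    (h : ∀ᶠ Y in nhds X, g Y = f Y) : HasVecJacobianAt g J X :=
  HasFDerivAt.congr_of_eventuallyEq hf.hasFDerivAt
    ((continuous_unvec (p := p) (q := q)).continuousAt (x := vec X) h)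

theorem HasMatJacobianAt.congr_of_eventuallyEq {f g : Matrix p q ℝ → Matrix r s ℝ}
    {J : Matrix (s × r) (q × p) ℝ} {X : Matrix p q ℝ} (hf : HasMatJacobianAt f J X)
    (h : ∀ᶠ Y in nhds X, g Y = f Y) : HasMatJacobianAt g J X :=
  HasVecJacobianAt.congr_of_eventuallyEq hf (h.mono fun _ hY => congrArg vec hY)

/-- Leibniz: the differential is df · g + f · dg, and vec turns right multiplication by g into gᵀ ⊗
I and left multiplication by f into I ⊗ f. -/
theorem HasMatJacobianAt.mul [DecidableEq r] [DecidableEq t] {f : Matrix p q ℝ → Matrix r s ℝ}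
    {g : Matrix p q ℝ → Matrix s t ℝ}
    {J : Matrix (s × r) (q × p) ℝ} {K : Matrix (t × s) (q × p) ℝ} {X : Matrix p q ℝ}
    (hf : HasMatJacobianAt f J X) (hg : HasMatJacobianAt g K X) :
    HasMatJacobianAt (fun Y => f Y * g Y)
      (((g X)ᵀ ⊗ₖ (1 : Matrix r r ℝ)) * J + ((1 : Matrix t t ℝ) ⊗ₖ f X) * K) X := by
  -- Work entrywise: each entry of the product is a finite sum of products of scalar functions.
  refine hasFDerivAt_pi'' fun a => ?_
  obtain ⟨c, i⟩ := a
  have hf' := fun j => hasFDerivAt_pi'.1 hf.hasFDerivAt (j, i)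
  have hg' := fun j => hasFDerivAt_pi'.1 hg.hasFDerivAt (c, j)
  have h := HasFDerivAt.fun_sum (u := Finset.univ) fun j _ => (hf' j).mul (hg' j)
  refine (h.congr_of_eventuallyEq (.of_forall fun x => ?_)).congr_fderiv ?_
  · simp [mul_apply]
  · ext1 x
    -- Applied to a direction, the claimed Jacobian is the vec of df · g + f · dg, whose entries can
    -- be compared with the scalar Leibniz sums.
    have e : (((g X)ᵀ ⊗ₖ (1 : Matrix r r ℝ)) * J + ((1 : Matrix t t ℝ) ⊗ₖ f X) * K) *ᵥ x
        = vec (unvec (J *ᵥ x) * g X + f X * unvec (K *ᵥ x)) := by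
      rw [add_mulVec, ← mulVec_mulVec, ← mulVec_mulVec, ← vec_unvec (J *ᵥ x),
        ← vec_unvec (K *ᵥ x), kronecker_mulVec_vec, kronecker_mulVec_vec]
      simp [unvec_vec]
    have e' := congrFun e (c, i)
    simp only [ContinuousLinearMap.comp_apply, ContinuousLinearMap.proj_apply,
      LinearMap.coe_toContinuousLinearMap', mulVecLin_apply]
    rw [e']
    simp [mul_apply, unvec_vec, Finset.sum_add_distrib, add_comm, mul_comm]
    simp [unvec]

theorem HasMatJacobianAt.transpose [DecidableEq r] [DecidableEq s]
    {f : Matrix p q ℝ → Matrix r s ℝ} {J : Matrix (s × r) (q × p) ℝ} {X : Matrix p q ℝ}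
    (hf : HasMatJacobianAt f J X) :
    HasMatJacobianAt (fun Y => (f Y)ᵀ) (commMat r s * J) X := by
  have h := HasVecJacobianAt.mulVec (commMat r s) hf
  simp only [commMat_mulVec_vec] at h
  exact h

/-- `vec` as a continuous linear map. -/
def vecCLM (p q : Type*) [Fintype p] [Fintype q] : Matrix p q ℝ →L[ℝ] (q × p → ℝ) where
  toFun := vec
  map_add' _ _ := rfl
  map_smul' _ _ := rfl
  cont := continuous_pi fun a => continuous_apply_apply a.2 a.1

/-- `unvec` as a continuous linear map. -/
def unvecCLM (p q : Type*) [Fintype p] [Fintype q] : (q × p → ℝ) →L[ℝ] Matrix p q ℝ where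
  toFun := unvec
  map_add' _ _ := rfl
  map_smul' _ _ := rfl
  cont := continuous_unvec

attribute [local instance] Matrix.linftyOpNormedRing Matrix.linftyOpNormedAlgebra in
-- The differential of inversion is H ↦ -A⁻¹ H A⁻¹, valid in any complete normed algebra. The
-- operator norm only serves to supply such a structure; `vecCLM` and `unvecCLM` carry the result to
-- coordinates, where the norm no longer appears.
theorem hasMatJacobianAt_inv [DecidableEq p] {A : Matrix p p ℝ} (hA : IsUnit A) :
    HasMatJacobianAt (fun B => B⁻¹) (-((A⁻¹)ᵀ ⊗ₖ A⁻¹)) A := by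
  obtain ⟨u, rfl⟩ := hA
  have h : HasFDerivAt (Ring.inverse : Matrix p p ℝ → Matrix p p ℝ) _ (unvecCLM p p (vec u.val)) :=
    hasFDerivAt_ringInverse (𝕜 := ℝ) u
  have h2 := (vecCLM p p).hasFDerivAt.comp _ (h.comp _ (unvecCLM p p).hasFDerivAt)
  refine (h2.congr_of_eventuallyEq (.of_forall fun x => ?_)).congr_fderiv ?_
  · exact congrArg vec (nonsing_inv_eq_ringInverse (unvec x))
  · ext1 x
    simp only [LinearMap.coe_toContinuousLinearMap', mulVecLin_apply]
    rw [← vec_unvec x, neg_mulVec, kronecker_mulVec_vec, transpose_transpose, ← vec_neg,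
      ← coe_units_inv]
    rfl

theorem HasMatJacobianAt.inv [DecidableEq r] {f : Matrix p q ℝ → Matrix r r ℝ}
    {J : Matrix (r × r) (q × p) ℝ} {X : Matrix p q ℝ} (hf : HasMatJacobianAt f J X)
    (hX : IsUnit (f X)) :
    HasMatJacobianAt (fun Y => (f Y)⁻¹) (-((f X)⁻¹ᵀ ⊗ₖ (f X)⁻¹) * J) X :=
  HasMatJacobianAt.comp X (hasMatJacobianAt_inv hX) hf

/-! ### Scalar functions: linear pairings and the squared Frobenius norm -/

theorem HasMatJacobianAt.hasRowDerivAt_dotProduct {f : Matrix p q ℝ → Matrix r s ℝ}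
    {J : Matrix (s × r) (q × p) ℝ} {X : Matrix p q ℝ} (v : s × r → ℝ)
    (hf : HasMatJacobianAt f J X) : HasRowDerivAt (fun Y => v ⬝ᵥ vec (f Y)) (Jᵀ *ᵥ v) X := by
  have h := HasVecJacobianAt.mulVec (replicateRow Unit v) hf
  refine HasVecJacobianAt.congr_jacobian h ?_
  ext _ a
  simp [mul_apply, mulVec, dotProduct, mul_comm]

theorem HasRowDerivAt.add {f g : Matrix p q ℝ → ℝ} {v w : q × p → ℝ} {X : Matrix p q ℝ}
    (hf : HasRowDerivAt f v X) (hg : HasRowDerivAt g w X) :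
    HasRowDerivAt (fun Y => f Y + g Y) (v + w) X :=
  HasVecJacobianAt.add hf hg

theorem HasRowDerivAt.sub {f g : Matrix p q ℝ → ℝ} {v w : q × p → ℝ} {X : Matrix p q ℝ}
    (hf : HasRowDerivAt f v X) (hg : HasRowDerivAt g w X) :
    HasRowDerivAt (fun Y => f Y - g Y) (v - w) X :=
  HasVecJacobianAt.sub hf hg

theorem HasRowDerivAt.const_mul {f : Matrix p q ℝ → ℝ} {v : q × p → ℝ} {X : Matrix p q ℝ} (c : ℝ)
    (hf : HasRowDerivAt f v X) : HasRowDerivAt (fun Y => c * f Y) (c • v) X :=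
  HasVecJacobianAt.const_smul c hf

theorem hasRowDerivAt_const (c : ℝ) (X : Matrix p q ℝ) :
    HasRowDerivAt (fun _ => c) 0 X :=
  hasVecJacobianAt_const (fun _ => c) X

theorem HasMatJacobianAt.hasRowDerivAt_frobSq {f : Matrix p q ℝ → Matrix r s ℝ}
    {J : Matrix (s × r) (q × p) ℝ} {X : Matrix p q ℝ} (hf : HasMatJacobianAt f J X) :
    HasRowDerivAt (fun Y => frobSq (f Y)) ((2 : ℝ) • (Jᵀ *ᵥ vec (f X))) X := by
  refine hasFDerivAt_pi'' fun _ => ?_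
  have hf' := hasFDerivAt_pi'.1 hf.hasFDerivAt
  have h := HasFDerivAt.fun_sum (u := Finset.univ) fun a _ => (hf' a).pow 2
  refine (h.congr_of_eventuallyEq (.of_forall fun x => ?_)).congr_fderiv ?_
  · simp only [frobSq, Fintype.sum_prod_type, vec]
    exact Finset.sum_comm
  · ext1 x
    simp [mulVec, dotProduct, Finset.mul_sum, Finset.sum_mul, unvec_vec]
    rw [Finset.sum_comm]
    refine Finset.sum_congr rfl fun i _ => Finset.sum_congr rfl fun j _ => by ring

end Calculus

/-! ### Pseudoinverse of a matrix of full row rank -/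

section Pseudoinverse

theorem isUnit_of_rank_eq_card {p : Type*} [Fintype p] [DecidableEq p] {A : Matrix p p ℝ}
    (h : A.rank = Fintype.card p) : IsUnit A := by
  rw [← mulVec_surjective_iff_isUnit]
  have h2 : LinearMap.range A.mulVecLin = ⊤ := by
    apply Submodule.eq_top_of_finrank_eq
    rw [Module.finrank_fintype_fun_eq_card]
    exact h
  exact LinearMap.range_eq_top.1 h2

/-- The candidate is a right inverse of A, which settles three of the Penrose equations; the fourth
is symmetry of Aᵀ(AAᵀ)⁻¹A. Uniqueness of the Moore-Penrose inverse does the rest. -/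
theorem pinv_eq_of_isUnit {p q : Type*} [Fintype p] [Fintype q] [DecidableEq p]
    {A : Matrix p q ℝ} (h : IsUnit (A * Aᵀ)) : pinv A = Aᵀ * (A * Aᵀ)⁻¹ := by
  have hd := (isUnit_iff_isUnit_det _).1 h
  have h1 : A * (Aᵀ * (A * Aᵀ)⁻¹) = 1 := by rw [← Matrix.mul_assoc, mul_nonsing_inv _ hd]
  refine (pinv_spec A).unique ⟨?_, ?_, ?_, ?_⟩
  · rw [h1, Matrix.one_mul]
  · rw [Matrix.mul_assoc, h1, Matrix.mul_one]
  · rw [h1, transpose_one]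
  · simp [transpose_nonsing_inv, Matrix.mul_assoc]

/-- The determinant of BBᵀ is continuous in B, so its nonvanishing is an open condition. Hence the
closed formula for the pseudoinverse holds on a neighbourhood, as differentiation requires. -/
theorem eventually_isUnit_mul_transpose {p q : Type*} [Fintype p] [Fintype q] [DecidableEq p]
    {A : Matrix p q ℝ} (h : IsUnit (A * Aᵀ)) : ∀ᶠ B in nhds A, IsUnit (B * Bᵀ) := by
  simp only [isUnit_iff_isUnit_det, isUnit_iff_ne_zero] at h ⊢
  have hc : Continuous fun B : Matrix p q ℝ => (B * Bᵀ).det := by fun_prop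
  exact hc.continuousAt.eventually_ne h

theorem proj_transpose {n m T : ℕ} (Γ : Matrix (Idx1 n m) (Fin T) ℝ) : (Proj Γ)ᵀ = Proj Γ := by
  rw [Proj, transpose_sub, (pinv_spec Γ).symm_right, transpose_one]

/-- With `proj_transpose` this says that Π is an orthogonal projection, from the Penrose equations
alone. It reduces ΠᵀΠ to Π in the gradient of ‖ΠL‖². -/
theorem proj_mul_self {n m T : ℕ} (Γ : Matrix (Idx1 n m) (Fin T) ℝ) :
    Proj Γ * Proj Γ = Proj Γ := by
  have h : pinv Γ * Γ * (pinv Γ * Γ) = pinv Γ * Γ := by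
    rw [← Matrix.mul_assoc, (pinv_spec Γ).self_mul_mul]
  simp [Proj, Matrix.mul_sub, Matrix.sub_mul, h]

theorem isUnit_mul_transpose_of_rank {n m T : ℕ} {Γ : Matrix (Idx1 n m) (Fin T) ℝ}
    (h : Γ.rank = m + n) : IsUnit (Γ * Γᵀ) := by
  apply isUnit_of_rank_eq_card
  rw [rank_self_mul_transpose, h]
  simp

theorem hasMatJacobianAt_pinv {n m T : ℕ} {Γ : Matrix (Idx1 n m) (Fin T) ℝ}
    (h : IsUnit (Γ * Γᵀ)) : HasMatJacobianAt (fun Γ' => pinv Γ') (dPinv Γ) Γ := by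
  have hid := hasMatJacobianAt_id Γ
  have h1 := hid.transpose.mul ((hid.mul hid.transpose).inv h)
  have h2 := h1.congr_of_eventuallyEq
    ((eventually_isUnit_mul_transpose h).mono fun _ hB => pinv_eq_of_isUnit hB)
  -- The product and inverse rules give the Jacobian in a differently bracketed form; both sides
  -- agree on every direction H after rewriting as matrix products.
  refine HasVecJacobianAt.congr_jacobian h2 (eq_of_forall_mulVec_vec fun H => ?_)
  simp only [dPinv, add_mulVec, sub_mulVec, neg_mulVec, ← mulVec_mulVec, commMat_mulVec_vec, kronecker_mulVec_vec, ← vec_add, Matrix.neg_mul,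
    Matrix.mul_neg, transpose_transpose, transpose_one, Matrix.one_mul, Matrix.mul_one]
  rw [sub_eq_add_neg]

/-- The Jacobian of `Π` with respect to `Γ`. -/
def dProj {n m T : ℕ} (Γ : Matrix (Idx1 n m) (Fin T) ℝ) :
    Matrix (Fin T × Fin T) (Fin T × Idx1 n m) ℝ :=
  -((Γᵀ ⊗ₖ (1 : Matrix (Fin T) (Fin T) ℝ)) * dPinv Γ)
    - (1 : Matrix (Fin T) (Fin T) ℝ) ⊗ₖ pinv Γ

theorem hasMatJacobianAt_proj {n m T : ℕ} {Γ : Matrix (Idx1 n m) (Fin T) ℝ}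
    (h : IsUnit (Γ * Γᵀ)) : HasMatJacobianAt (fun Γ' => Proj Γ') (dProj Γ) Γ := by
  have h1 := (hasMatJacobianAt_pinv h).mul (hasMatJacobianAt_id Γ)
  have h2 := HasVecJacobianAt.sub (hasMatJacobianAt_const (1 : Matrix (Fin T) (Fin T) ℝ) Γ) h1
  refine HasVecJacobianAt.congr_jacobian h2 ?_
  rw [dProj, Matrix.mul_one, zero_sub, neg_add, sub_eq_add_neg]

theorem dProjdX_eq {n m T : ℕ} (Γ : Matrix (Idx1 n m) (Fin T) ℝ) :
    dProjdX Γ = dProj Γ * dGamdX n m T := by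
  simp only [dProjdX, dProj, Matrix.sub_mul, Matrix.neg_mul]

theorem dProjdU_eq {n m T : ℕ} (Γ : Matrix (Idx1 n m) (Fin T) ℝ) :
    dProjdU Γ = dProj Γ * dGamdU n m T := by
  simp only [dProjdU, dProj, Matrix.sub_mul, Matrix.neg_mul]

end Pseudoinverse

/-! ### Derivatives of the constraint blocks -/

section Blocks

variable {n m T : ℕ}

theorem EX_mul (D : Matrix (DIdx n m) (Fin T) ℝ) : EX n m * D = dataX D := by
  ext i j; simp [EX, dataX, mul_apply, Matrix.one_apply, toRows₁, toRows₂]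

theorem EU_mul (D : Matrix (DIdx n m) (Fin T) ℝ) : EU n m * D = dataU D := by
  ext i j; simp [EU, dataU, mul_apply, Matrix.one_apply, toRows₂]

theorem EZ_mul (D : Matrix (DIdx n m) (Fin T) ℝ) : EZ n m * D = dataZ D := by
  ext i j; simp [EZ, dataZ, mul_apply, Matrix.one_apply, toRows₁]

theorem VEU_mul (V : Matrix (Fin m) (Fin m) ℝ) (D : Matrix (DIdx n m) (Fin T) ℝ) :
    (VEU V : Matrix (Idx1 n m) (DIdx n m) ℝ) * D = fromRows (V * dataU D) (0 : Matrix (Fin n) (Fin T) ℝ) := by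
  rw [VEU, fromRows_mul, Matrix.mul_assoc, EU_mul, Matrix.zero_mul]

theorem lowEX1_mul (D : Matrix (DIdx n m) (Fin T) ℝ) :
    lowEX1 n m * D = fromRows (0 : Matrix (Fin m) (Fin T) ℝ) (dataX D) := by
  rw [lowEX1, fromRows_mul, EX_mul, Matrix.zero_mul]

theorem upEX2_mul (D : Matrix (DIdx n m) (Fin T) ℝ) :
    upEX2 n m * D = fromRows (dataX D) (0 : Matrix (Fin n) (Fin T) ℝ) := by
  rw [upEX2, fromRows_mul, EX_mul, Matrix.zero_mul]

theorem lowEX2_mul (D : Matrix (DIdx n m) (Fin T) ℝ) :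
    lowEX2 n m * D = fromRows (0 : Matrix (Fin n) (Fin T) ℝ) (dataX D) := by
  rw [lowEX2, fromRows_mul, EX_mul, Matrix.zero_mul]

theorem upEZ2_mul (D : Matrix (DIdx n m) (Fin T) ℝ) :
    upEZ2 n m * D = fromRows (dataZ D) (0 : Matrix (Fin n) (Fin T) ℝ) := by
  rw [upEZ2, fromRows_mul, EZ_mul, Matrix.zero_mul]

/-! ### The blocks as affine functions of L, of S and of D -/

theorem vec_F1_eq_dL (V : Matrix (Fin m) (Fin m) ℝ) (L : Matrix (Fin T) (Fin n) ℝ)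
    (S : Matrix (Fin m) (Fin m) ℝ) (D : Matrix (DIdx n m) (Fin T) ℝ) :
    vec (F1 V L S D) = dF1dL V D *ᵥ vec L + vec (fromBlocks S 0 0 0) := by
  simp only [dF1dL, add_mulVec, ← mulVec_mulVec, commMat_mulVec_vec, kronecker_mulVec_vec,
    ← vec_add]
  congr 1
  -- The three Kronecker terms are [VU;0] L [0;I]ᵀ, its transpose, and [0;X] L [0;I]ᵀ; they fill the
  -- off-diagonal blocks and the lower right one.
  simp only [F1, low1, transpose_fromRows, fromRows_mul, mul_fromCols, transpose_mul,
    transpose_zero, transpose_one, Matrix.zero_mul, Matrix.mul_zero, Matrix.one_mul,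
    Matrix.mul_one, Matrix.mul_assoc]
  ext (i | i) (j | j) <;> simp

theorem vec_F2_eq_dL (L : Matrix (Fin T) (Fin n) ℝ) (D : Matrix (DIdx n m) (Fin T) ℝ) :
    vec (F2 L D) = dF2dL D *ᵥ vec L + vec (fromBlocks (-1) 0 0 0) := by
  simp only [dF2dL, add_mulVec, ← mulVec_mulVec, commMat_mulVec_vec, kronecker_mulVec_vec,
    ← vec_add]
  congr 1
  simp only [F2, low2, up2, transpose_fromRows, fromRows_mul, mul_fromCols, transpose_mul,
    transpose_zero, transpose_one, Matrix.zero_mul, Matrix.mul_zero, Matrix.one_mul,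
    Matrix.mul_one]
  ext (i | i) (j | j) <;> simp [sub_eq_add_neg]

theorem vec_F1_eq_dS (V : Matrix (Fin m) (Fin m) ℝ) (L : Matrix (Fin T) (Fin n) ℝ)
    (S : Matrix (Fin m) (Fin m) ℝ) (D : Matrix (DIdx n m) (Fin T) ℝ) :
    vec (F1 V L S D) = dF1dS n m *ᵥ vec S
      + vec (fromBlocks 0 (V * dataU D * L) (V * dataU D * L)ᵀ (dataX D * L)) := by
  simp only [dF1dS, kronecker_mulVec_vec, ← vec_add]
  congr 1
  simp only [F1, up1, transpose_fromRows, fromRows_mul, mul_fromCols, transpose_zero,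
    transpose_one, Matrix.zero_mul, Matrix.mul_zero, Matrix.one_mul, Matrix.mul_one]
  ext (i | i) (j | j) <;> simp

/-- The definition with its index types spelled out, used as the rewriting form. -/
theorem dF1dD_eq (V : Matrix (Fin m) (Fin m) ℝ) (L : Matrix (Fin T) (Fin n) ℝ) :
    dF1dD V L = fromRows (0 : Matrix (Fin m) (Fin T) ℝ) Lᵀ ⊗ₖ (VEU V : Matrix (Idx1 n m) _ ℝ)
      + ((VEU V : Matrix (Idx1 n m) (DIdx n m) ℝ) ⊗ₖ (fromRows (0 : Matrix (Fin m) (Fin T) ℝ) Lᵀ :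
          Matrix (Idx1 n m) (Fin T) ℝ) : Matrix (Idx1 n m × Idx1 n m) (DIdx n m × Fin T) ℝ)
        * (commMat (DIdx n m) (Fin T) : Matrix (DIdx n m × Fin T) (Fin T × DIdx n m) ℝ)
      + fromRows (0 : Matrix (Fin m) (Fin T) ℝ) Lᵀ ⊗ₖ lowEX1 n m :=
  rfl

theorem vec_F1_eq_dD (V : Matrix (Fin m) (Fin m) ℝ) (L : Matrix (Fin T) (Fin n) ℝ)
    (S : Matrix (Fin m) (Fin m) ℝ) (D : Matrix (DIdx n m) (Fin T) ℝ) :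
    vec (F1 V L S D) = dF1dD V L *ᵥ vec D + vec (fromBlocks S 0 0 0) := by
  have e : ((VEU V : Matrix (Idx1 n m) (DIdx n m) ℝ) * D)ᵀ
    = fromCols (V * dataU D)ᵀ (0 : Matrix (Fin T) (Fin n) ℝ) := by
    rw [VEU_mul, transpose_fromRows, transpose_zero]
  simp only [dF1dD_eq, add_mulVec, ← mulVec_mulVec, commMat_mulVec_vec, kronecker_mulVec_vec,
    ← vec_add]
  congr 1
  -- The commutation term is [0;Lᵀ] Dᵀ [VE_U;0]ᵀ; grouping the last two factors exposes ([VE_U;0]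
  -- D)ᵀ = [VU;0]ᵀ.
  rw [Matrix.mul_assoc _ Dᵀ, ← transpose_mul, e, VEU_mul, lowEX1_mul]
  simp only [F1, transpose_fromRows, fromRows_mul, mul_fromCols, transpose_mul, transpose_zero,
    transpose_transpose, Matrix.zero_mul, Matrix.mul_zero, Matrix.mul_assoc]
  ext (i | i) (j | j) <;> simp

theorem vec_F2_eq_dD (L : Matrix (Fin T) (Fin n) ℝ) (D : Matrix (DIdx n m) (Fin T) ℝ) :
    vec (F2 L D) = dF2dD m L *ᵥ vec D + vec (fromBlocks (-1) 0 0 0) := by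
  have e : (upEZ2 n m * D)ᵀ = fromCols (dataZ D)ᵀ (0 : Matrix (Fin T) (Fin n) ℝ) := by
    rw [upEZ2_mul, transpose_fromRows, transpose_zero]
  simp only [dF2dD, add_mulVec, ← mulVec_mulVec, commMat_mulVec_vec, kronecker_mulVec_vec,
    ← vec_add]
  congr 1
  rw [Matrix.mul_assoc _ Dᵀ, ← transpose_mul, e, upEX2_mul, upEZ2_mul, lowEX2_mul]
  simp only [F2, transpose_fromRows, fromRows_mul, mul_fromCols, transpose_mul, transpose_zero,
    transpose_transpose, Matrix.zero_mul, Matrix.mul_zero]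
  ext (i | i) (j | j) <;> simp [sub_eq_add_neg]

/-- Block-diagonal placement is F = Ē₁F₁Ē₁ᵀ + Ē₂F₂Ē₂ᵀ, and vec turns each congruence into Ēᵢ ⊗ Ēᵢ.
-/
theorem vec_F (V : Matrix (Fin m) (Fin m) ℝ) (L : Matrix (Fin T) (Fin n) ℝ)
    (S : Matrix (Fin m) (Fin m) ℝ) (D : Matrix (DIdx n m) (Fin T) ℝ) :
    vec (F V L S D) = E1 n m *ᵥ vec (F1 V L S D) + E2 n m *ᵥ vec (F2 L D) := by
  simp only [E1, E2, kronecker_mulVec_vec, ← vec_add]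
  congr 1
  simp only [F, E1bar, E2bar, transpose_fromRows, fromRows_mul, mul_fromCols, transpose_zero,
    transpose_one, Matrix.zero_mul, Matrix.mul_zero, Matrix.one_mul, Matrix.mul_one]
  ext (i | i) (j | j) <;> simp

theorem hasMatJacobianAt_F {p q : Type*} [Fintype p] [Fintype q] {V : Matrix (Fin m) (Fin m) ℝ}
    {L : Matrix p q ℝ → Matrix (Fin T) (Fin n) ℝ} {S : Matrix p q ℝ → Matrix (Fin m) (Fin m) ℝ}
    {D : Matrix p q ℝ → Matrix (DIdx n m) (Fin T) ℝ} {X : Matrix p q ℝ}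
    {J : Matrix (Idx1 n m × Idx1 n m) (q × p) ℝ} {K : Matrix (Idx2 n × Idx2 n) (q × p) ℝ}
    (h1 : HasMatJacobianAt (fun Y => F1 V (L Y) (S Y) (D Y)) J X)
    (h2 : HasMatJacobianAt (fun Y => F2 (L Y) (D Y)) K X) :
    HasMatJacobianAt (fun Y => F V (L Y) (S Y) (D Y)) (E1 n m * J + E2 n m * K) X := by
  unfold HasMatJacobianAt
  simp only [vec_F]
  exact (HasVecJacobianAt.mulVec _ h1).add (HasVecJacobianAt.mulVec _ h2)

/-! ### First-order Jacobians of F₁, F₂ and F -/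

variable (V : Matrix (Fin m) (Fin m) ℝ) (L : Matrix (Fin T) (Fin n) ℝ)
  (S : Matrix (Fin m) (Fin m) ℝ) (D : Matrix (DIdx n m) (Fin T) ℝ)

theorem hasMatJacobianAt_F1_L : HasMatJacobianAt (fun L' => F1 V L' S D) (dF1dL V D) L :=
  hasMatJacobianAt_of_affine _ _ (fun L' => vec_F1_eq_dL V L' S D) L

theorem hasMatJacobianAt_F2_L : HasMatJacobianAt (fun L' => F2 L' D) (dF2dL D) L :=
  hasMatJacobianAt_of_affine _ _ (fun L' => vec_F2_eq_dL L' D) L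

theorem hasMatJacobianAt_F_L : HasMatJacobianAt (fun L' => F V L' S D) (dFdL V D) L :=
  hasMatJacobianAt_F (hasMatJacobianAt_F1_L V L S D) (hasMatJacobianAt_F2_L L D)

theorem hasMatJacobianAt_F1_S : HasMatJacobianAt (fun S' => F1 V L S' D) (dF1dS n m) S :=
  hasMatJacobianAt_of_affine _ _ (fun S' => vec_F1_eq_dS V L S' D) S

theorem hasMatJacobianAt_F2_S :
    HasMatJacobianAt (fun _ : Matrix (Fin m) (Fin m) ℝ => F2 L D) (dF2dS n m) S :=
  hasMatJacobianAt_const _ S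

theorem hasMatJacobianAt_F_S : HasMatJacobianAt (fun S' => F V L S' D) (dFdS n m) S :=
  hasMatJacobianAt_F (hasMatJacobianAt_F1_S V L S D) (hasMatJacobianAt_F2_S L S D)

theorem hasMatJacobianAt_F1_D : HasMatJacobianAt (fun D' => F1 V L S D') (dF1dD V L) D :=
  hasMatJacobianAt_of_affine _ _ (fun D' => vec_F1_eq_dD V L S D') D

theorem hasMatJacobianAt_F2_D : HasMatJacobianAt (fun D' => F2 L D') (dF2dD m L) D :=
  hasMatJacobianAt_of_affine _ _ (fun D' => vec_F2_eq_dD L D') D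

theorem hasMatJacobianAt_F_D : HasMatJacobianAt (fun D' => F V L S D') (dFdD V L) D :=
  hasMatJacobianAt_F (hasMatJacobianAt_F1_D V L S D) (hasMatJacobianAt_F2_D L D)

/-! ### Second derivatives -/

/-- Both vec(A ⊗ B) and vec(A) ⊗ vec(B) list the products A k i * B l j, the first indexed by
((i,j),(k,l)) and the second by ((i,k),(j,l)). The factor I ⊗ C ⊗ I swaps the two middle indices.
Written so, the expression is visibly linear in B. -/
theorem vec_kronecker_eq_colKronEye {a b c d : Type*} [Fintype a] [Fintype b] [Fintype c]
    [Fintype d] [DecidableEq a] [DecidableEq b] [DecidableEq c] [DecidableEq d]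
    (A : Matrix c a ℝ) (B : Matrix d b ℝ) :
    vec (A ⊗ₖ B) = eyeCommEye a b c d *ᵥ (colKronEye (b × d) (vec A) *ᵥ vec B) := by
  have h : colKronEye (b × d) (vec A) *ᵥ vec B = fun x => vec A x.1 * vec B x.2 := by
    ext x
    simp [colKronEye, mulVec, dotProduct, Matrix.one_apply]
  rw [h]
  ext ⟨⟨i, j⟩, ⟨k, l⟩⟩
  simp [eyeCommEye, assoc4, commMat, mulVec, dotProduct, Fintype.sum_prod_type, Matrix.one_apply,
    ite_and]

/-- The same vector vec(A) ⊗ vec(B), now read as linear in A. This serves the commutation terms,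
where the data sits in the left factor. -/
theorem vec_kronecker_eq_eyeKronCol {a b c d : Type*} [Fintype a] [Fintype b] [Fintype c]
    [Fintype d] [DecidableEq a] [DecidableEq b] [DecidableEq c] [DecidableEq d]
    (A : Matrix c a ℝ) (B : Matrix d b ℝ) :
    vec (A ⊗ₖ B) = eyeCommEye a b c d *ᵥ (eyeKronCol (a × c) (vec B) *ᵥ vec A) := by
  have h : eyeKronCol (a × c) (vec B) *ᵥ vec A = colKronEye (b × d) (vec A) *ᵥ vec B := by
    ext x
    simp [colKronEye, eyeKronCol, mulVec, dotProduct, Matrix.one_apply, mul_comm]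
  rw [h, vec_kronecker_eq_colKronEye]

theorem one_kronecker_mulVec_vec {a b c : Type*} [Fintype a] [Fintype b] [DecidableEq a]
    (A : Matrix c b ℝ) (B : Matrix b a ℝ) :
    ((1 : Matrix a a ℝ) ⊗ₖ A) *ᵥ vec B = vec (A * B) := by
  rw [kronecker_mulVec_vec, transpose_one, Matrix.mul_one]

theorem transpose_kronecker_one_mulVec_vec {a b c : Type*} [Fintype a] [Fintype b]
    [DecidableEq b] (A : Matrix a c ℝ) (B : Matrix b a ℝ) :
    (Aᵀ ⊗ₖ (1 : Matrix b b ℝ)) *ᵥ vec B = vec (B * A) := by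
  rw [kronecker_mulVec_vec, transpose_transpose, Matrix.one_mul]

theorem d2F1dDdL_eq :
    d2F1dDdL T V = C1 n m T * colKronEye (Fin T × Idx1 n m) (vec (low1 n m))
        * ((1 : Matrix (Fin T) (Fin T) ℝ) ⊗ₖ (VEU V : Matrix (Idx1 n m) (DIdx n m) ℝ))
      + C1 n m T * colKronEye (Fin T × Idx1 n m) (vec (low1 n m))
        * ((1 : Matrix (Fin T) (Fin T) ℝ) ⊗ₖ lowEX1 n m)
      + ((commMat (Fin T) (Fin n))ᵀ
          ⊗ₖ (1 : Matrix (Idx1 n m × Idx1 n m) (Idx1 n m × Idx1 n m) ℝ))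
        * C1t n m T * eyeKronCol (Fin T × Idx1 n m) (vec (low1 n m))
        * ((1 : Matrix (Fin T) (Fin T) ℝ) ⊗ₖ (VEU V : Matrix (Idx1 n m) (DIdx n m) ℝ)) :=
  rfl

theorem d2FdDdL_eq :
    d2FdDdL T V = ((1 : Matrix (Fin n × Fin T) (Fin n × Fin T) ℝ) ⊗ₖ E1 n m)
        * (d2F1dDdL T V : Matrix _ (Fin T × DIdx n m) ℝ)
      + ((1 : Matrix (Fin n × Fin T) (Fin n × Fin T) ℝ) ⊗ₖ E2 n m) * d2F2dDdL n m T :=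
  rfl

/-- ∂F₁/∂L is linear in D with no constant part, so its coefficient matrix is the second derivative.
Right multiplication by C_{T,n} in the middle term becomes the factor C_{T,n}ᵀ ⊗ I. -/
theorem vec_dF1dL : vec (dF1dL V D) = d2F1dDdL T V *ᵥ vec D := by
  simp only [d2F1dDdL_eq, add_mulVec, ← mulVec_mulVec, one_kronecker_mulVec_vec]
  simp only [C1, C1t, ← vec_kronecker_eq_colKronEye, ← vec_kronecker_eq_eyeKronCol,
    transpose_kronecker_one_mulVec_vec, ← vec_add, VEU_mul, lowEX1_mul, dF1dL]
  congr 1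
  -- The commutation term is second in ∂F₁/∂L and last in its derivative.
  abel

theorem vec_dF2dL : vec (dF2dL D) = d2F2dDdL n m T *ᵥ vec D := by
  simp only [d2F2dDdL, add_mulVec, ← mulVec_mulVec, one_kronecker_mulVec_vec]
  simp only [C2, C2t, ← vec_kronecker_eq_colKronEye, ← vec_kronecker_eq_eyeKronCol,
    transpose_kronecker_one_mulVec_vec, ← vec_add, upEX2_mul, upEZ2_mul, lowEX2_mul, dF2dL]

theorem vec_dFdL : vec (dFdL V D) = d2FdDdL T V *ᵥ vec D := by
  simp only [d2FdDdL_eq, add_mulVec, ← mulVec_mulVec, ← vec_dF1dL, ← vec_dF2dL,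
    one_kronecker_mulVec_vec, ← vec_add, dFdL]

theorem hasMatJacobianAt_dF1dL :
    HasMatJacobianAt (fun D' => dF1dL V D') (d2F1dDdL T V) D :=
  hasMatJacobianAt_of_affine _ 0 (fun D' => by rw [vec_dF1dL, vec_zero, add_zero]) D

theorem hasMatJacobianAt_dF2dL :
    HasMatJacobianAt (fun D' => dF2dL D') (d2F2dDdL n m T) D :=
  hasMatJacobianAt_of_affine _ 0 (fun D' => by rw [vec_dF2dL, vec_zero, add_zero]) D

theorem hasMatJacobianAt_dFdL :
    HasMatJacobianAt (fun D' => dFdL V D') (d2FdDdL T V) D :=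
  hasMatJacobianAt_of_affine _ 0 (fun D' => by rw [vec_dFdL, vec_zero, add_zero]) D

end Blocks

/-! ### Gradients of the Lagrangian -/

section Gradients

variable {n m T : ℕ} (Q : Matrix (Fin n) (Fin n) ℝ) (V : Matrix (Fin m) (Fin m) ℝ) (γ : ℝ)
  (L : Matrix (Fin T) (Fin n) ℝ) (S : Matrix (Fin m) (Fin m) ℝ)
  (Λ : Matrix (FIdx n m) (FIdx n m) ℝ) (D : Matrix (DIdx n m) (Fin T) ℝ)

theorem trace_mul_transpose_eq_vec_dotProduct {p q : Type*} [Fintype p] [Fintype q]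
    (A B : Matrix p q ℝ) : (A * Bᵀ).trace = vec B ⬝ᵥ vec A := by
  rw [vec_dotProduct_vec, trace_mul_comm]

theorem hasMatJacobianAt_const_mul {p q r : Type*} [Fintype p] [Fintype q] [Fintype r]
    [DecidableEq q] (A : Matrix r p ℝ) (X : Matrix p q ℝ) :
    HasMatJacobianAt (fun Y => A * Y) ((1 : Matrix q q ℝ) ⊗ₖ A) X :=
  hasMatJacobianAt_of_affine _ 0 (fun Y => by
    rw [one_kronecker_mulVec_vec, vec_zero, add_zero]) X

theorem hasMatJacobianAt_mul_const {p q r : Type*} [Fintype p] [Fintype q] [Fintype r]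
    [DecidableEq p] (A : Matrix q r ℝ) (X : Matrix p q ℝ) :
    HasMatJacobianAt (fun Y => Y * A) (Aᵀ ⊗ₖ (1 : Matrix p p ℝ)) X :=
  hasMatJacobianAt_of_affine _ 0 (fun Y => by
    rw [transpose_kronecker_one_mulVec_vec, vec_zero, add_zero]) X

theorem hasRowDerivAt_lagr_L : HasRowDerivAt (fun L' => lagr Q V γ L' S Λ D)
    (vec (Q * dataX D)ᵀ + (2 * γ) • vec (Proj (GamD D) * L) - (dFdL V D)ᵀ *ᵥ vec Λ) L := by
  have h1 := (hasMatJacobianAt_id L).hasRowDerivAt_dotProduct (vec (Q * dataX D)ᵀ)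
  have h2 := (hasMatJacobianAt_const_mul (Proj (GamD D)) L).hasRowDerivAt_frobSq
  have h3 := (hasMatJacobianAt_F_L V L S D).hasRowDerivAt_dotProduct (vec Λ)
  have h := ((h1.add (hasRowDerivAt_const S.trace L)).add (h2.const_mul γ)).sub h3
  -- The pairings become traces again: vec((QX)ᵀ) · vec(L) is tr(QXL) up to cyclicity, and vec(Λ) ·
  -- vec(F) is tr(FΛᵀ).
  simp only [← trace_mul_transpose_eq_vec_dotProduct, transpose_transpose] at h
  simp only [trace_mul_comm _ (Q * dataX D)] at h
  -- The Frobenius term arrives as γ · 2 vec(ΠᵀΠL); symmetry and idempotence of Π leave 2γ vec(ΠL).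
  rw [transpose_one, one_mulVec, add_zero, ← kroneckerMap_transpose, transpose_one,
    proj_transpose, one_kronecker_mulVec_vec, ← Matrix.mul_assoc, proj_mul_self, smul_smul,
    mul_comm γ 2] at h
  exact h

theorem hasRowDerivAt_lagr_S : HasRowDerivAt (fun S' => lagr Q V γ L S' Λ D)
    (vec 1 - (dFdS n m)ᵀ *ᵥ vec Λ) S := by
  have h1 := (hasMatJacobianAt_id S).hasRowDerivAt_dotProduct (vec 1)
  have h3 := (hasMatJacobianAt_F_S V L S D).hasRowDerivAt_dotProduct (vec Λ)
  have h := (((hasRowDerivAt_const (Q * dataX D * L).trace S).add h1).add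
    (hasRowDerivAt_const (γ * frobSq (Proj (GamD D) * L)) S)).sub h3
  simp only [← trace_mul_transpose_eq_vec_dotProduct, transpose_one, Matrix.mul_one, one_mulVec,
    zero_add, add_zero] at h
  exact h

theorem G1_eq : G1 Q V γ L S Λ D
    = vec (Q * dataX D)ᵀ + (2 * γ) • vec (Proj (GamD D) * L) - (dFdL V D)ᵀ *ᵥ vec Λ :=
  (hasRowDerivAt_lagr_L Q V γ L S Λ D).rowDeriv_eq

theorem G2_eq : G2 Q V γ L S Λ D = vec 1 - (dFdS n m)ᵀ *ᵥ vec Λ :=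
  (hasRowDerivAt_lagr_S Q V γ L S Λ D).rowDeriv_eq

/-- Each entry of Aᵀv pairs v with a column of A. Exchanging the roles of matrix and vector makes
the multiplier the constant and ∂F/∂L the variable when G₁ is differentiated in D. -/
theorem transpose_mulVec_eq_eyeKronRow {k a : Type*} [Fintype k] [Fintype a] [DecidableEq k]
    (A : Matrix a k ℝ) (v : a → ℝ) : Aᵀ *ᵥ v = eyeKronRow k v *ᵥ vec A := by
  ext i
  simp [eyeKronRow, mulVec, dotProduct, Fintype.sum_prod_type, Matrix.one_apply, mul_comm,
    Finset.sum_ite_irrel]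

/-! ### Derivatives of `Γ` and `Π` with respect to the data -/

theorem hasMatJacobianAt_Gam_X (X : Matrix (Fin n) (Fin T) ℝ) (U : Matrix (Fin m) (Fin T) ℝ) :
    HasMatJacobianAt (fun X' => Gam X' U) (dGamdX n m T) X :=
  hasMatJacobianAt_of_affine _ (fromRows U 0) (fun X' => by
    rw [dGamdX, one_kronecker_mulVec_vec, ← vec_add]
    congr 1
    ext (i | i) j <;> simp [Gam, low1, fromRows_mul]) X

theorem hasMatJacobianAt_Gam_U (X : Matrix (Fin n) (Fin T) ℝ) (U : Matrix (Fin m) (Fin T) ℝ) :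
    HasMatJacobianAt (fun U' => Gam X U') (dGamdU n m T) U :=
  hasMatJacobianAt_of_affine _ (fromRows 0 X) (fun U' => by
    rw [dGamdU, one_kronecker_mulVec_vec, ← vec_add]
    congr 1
    ext (i | i) j <;> simp [Gam, up1, fromRows_mul]) U

theorem hasMatJacobianAt_GamD : HasMatJacobianAt (fun D' => GamD D')
    (dGamdX n m T * ((1 : Matrix (Fin T) (Fin T) ℝ) ⊗ₖ EX n m)
      + dGamdU n m T * ((1 : Matrix (Fin T) (Fin T) ℝ) ⊗ₖ EU n m)) D :=
  hasMatJacobianAt_of_affine _ 0 (fun D' => by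
    rw [dGamdX, dGamdU, add_mulVec, ← mulVec_mulVec, ← mulVec_mulVec]
    simp only [one_kronecker_mulVec_vec, EX_mul, EU_mul, ← vec_add]
    congr 1
    ext (i | i) j <;> simp [GamD, Gam, low1, up1, fromRows_mul]) D

variable {D}

theorem hasMatJacobianAt_proj_X (h : IsUnit (GamD D * (GamD D)ᵀ)) :
    HasMatJacobianAt (fun X' => Proj (Gam X' (dataU D))) (dProjdX (GamD D)) (dataX D) :=
  dProjdX_eq (GamD D) ▸ HasMatJacobianAt.comp (dataX D) (f := fun X' => Gam X' (dataU D))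
    (hasMatJacobianAt_proj h) (hasMatJacobianAt_Gam_X _ _)

theorem hasMatJacobianAt_proj_U (h : IsUnit (GamD D * (GamD D)ᵀ)) :
    HasMatJacobianAt (fun U' => Proj (Gam (dataX D) U')) (dProjdU (GamD D)) (dataU D) :=
  dProjdU_eq (GamD D) ▸ HasMatJacobianAt.comp (dataU D) (f := fun U' => Gam (dataX D) U')
    (hasMatJacobianAt_proj h) (hasMatJacobianAt_Gam_U _ _)

theorem hasMatJacobianAt_proj_D (h : IsUnit (GamD D * (GamD D)ᵀ)) :
    HasMatJacobianAt (fun D' => Proj (GamD D')) (dProjdD (GamD D)) D := by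
  refine HasVecJacobianAt.congr_jacobian
    (HasMatJacobianAt.comp D (hasMatJacobianAt_proj h) (hasMatJacobianAt_GamD D)) ?_
  rw [dProjdD, dProjdX_eq, dProjdU_eq, Matrix.mul_add, Matrix.mul_assoc, Matrix.mul_assoc]

/-! ### Derivatives of the components of the KKT system -/

theorem hasVecJacobianAt_G1_L : HasVecJacobianAt (fun L' => G1 Q V γ L' S Λ D)
    ((2 * γ) • ((1 : Matrix (Fin n) (Fin n) ℝ) ⊗ₖ Proj (GamD D))) L := by
  simp only [G1_eq]
  refine hasVecJacobianAt_of_affine _ (vec (Q * dataX D)ᵀ - (dFdL V D)ᵀ *ᵥ vec Λ)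
    (fun L' => ?_) L
  rw [smul_mulVec, one_kronecker_mulVec_vec]
  abel

theorem hasVecJacobianAt_G1_Λ : HasVecJacobianAt (fun Λ' => G1 Q V γ L S Λ' D)
    (-(dFdL V D)ᵀ) Λ := by
  simp only [G1_eq]
  refine hasVecJacobianAt_of_affine _ (vec (Q * dataX D)ᵀ + (2 * γ) • vec (Proj (GamD D) * L))
    (fun Λ' => ?_) Λ
  rw [neg_mulVec]
  abel

/-- Among the KKT blocks, only this one differentiates Π and so needs ΓΓᵀ invertible. The three
summands of `G1_eq` are handled separately: a transpose of a linear term, the chain rule through Π,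
and the linear map D ↦ ∂F/∂L. -/
theorem hasVecJacobianAt_G1_D (h : IsUnit (GamD D * (GamD D)ᵀ)) :
    HasVecJacobianAt (fun D' => G1 Q V γ L S Λ D')
      (commMat (Fin n) (Fin T) * ((1 : Matrix (Fin T) (Fin T) ℝ) ⊗ₖ (Q * EX n m))
        + (2 * γ) • ((Lᵀ ⊗ₖ (1 : Matrix (Fin T) (Fin T) ℝ)) * dProjdD (GamD D))
        - eyeKronRow (Fin n × Fin T) (vec Λ) * d2FdDdL T V) D := by
  simp only [G1_eq]
  have h1 := (hasMatJacobianAt_const_mul (Q * EX n m) D).transpose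
  simp only [Matrix.mul_assoc, EX_mul] at h1
  have h2 := HasVecJacobianAt.const_smul (2 * γ)
    (HasMatJacobianAt.comp D (hasMatJacobianAt_mul_const L _) (hasMatJacobianAt_proj_D h))
  have h3 := HasVecJacobianAt.mulVec (eyeKronRow (Fin n × Fin T) (vec Λ))
    (hasMatJacobianAt_dFdL V D)
  simp only [← transpose_mulVec_eq_eyeKronRow] at h3
  exact (HasVecJacobianAt.add h1 h2).sub h3

theorem hasVecJacobianAt_G2_Λ : HasVecJacobianAt (fun Λ' => G2 Q V γ L S Λ' D)
    (-(dFdS n m)ᵀ) Λ := by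
  simp only [G2_eq]
  refine hasVecJacobianAt_of_affine _ (vec 1) (fun Λ' => ?_) Λ
  rw [neg_mulVec]
  abel

theorem HasMatJacobianAt.mul_transpose_const {p q r s t : Type*} [Fintype p] [Fintype q]
    [Fintype r] [Fintype s] [Fintype t] [DecidableEq r] {f : Matrix p q ℝ → Matrix r s ℝ}
    {J : Matrix (s × r) (q × p) ℝ} {X : Matrix p q ℝ} (hf : HasMatJacobianAt f J X)
    (A : Matrix t s ℝ) :
    HasMatJacobianAt (fun Y => f Y * Aᵀ) ((A ⊗ₖ (1 : Matrix r r ℝ)) * J) X := by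
  have h := HasMatJacobianAt.comp X (hasMatJacobianAt_mul_const Aᵀ (f X)) hf
  rwa [transpose_transpose] at h

variable (D)

theorem hasMatJacobianAt_G3_Λ : HasMatJacobianAt (fun Λ' => G3 V L S Λ' D)
    (((1 : Matrix (FIdx n m) (FIdx n m) ℝ) ⊗ₖ F V L S D) * commMat (FIdx n m) (FIdx n m)) Λ :=
  hasMatJacobianAt_of_affine _ 0 (fun Λ' => by
    rw [← mulVec_mulVec, commMat_mulVec_vec, one_kronecker_mulVec_vec, vec_zero, add_zero, G3]) Λ

theorem hasMatJacobianAt_G4 : HasMatJacobianAt (fun Λ' => G4 Λ')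
    (1 - commMat (FIdx n m) (FIdx n m)) Λ :=
  hasMatJacobianAt_of_affine _ 0 (fun Λ' => by
    rw [sub_mulVec, one_mulVec, commMat_mulVec_vec, vec_zero, add_zero, G4, vec_sub]) Λ

/-! ### Second derivatives as Jacobians of actual first Jacobians -/

theorem hasMatJacobianAt_matJacobian_F1_L :
    HasMatJacobianAt (fun D' => matJacobian (fun L' => F1 V L' S D') L) (d2F1dDdL T V) D := by
  simpa only [(hasMatJacobianAt_F1_L V L S _).matJacobian_eq] using hasMatJacobianAt_dF1dL V D

theorem hasMatJacobianAt_matJacobian_F2_L :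
    HasMatJacobianAt (fun D' => matJacobian (fun L' => F2 L' D') L) (d2F2dDdL n m T) D := by
  simpa only [(hasMatJacobianAt_F2_L L _).matJacobian_eq] using hasMatJacobianAt_dF2dL D

theorem hasMatJacobianAt_matJacobian_F_L :
    HasMatJacobianAt (fun D' => matJacobian (fun L' => F V L' S D') L) (d2FdDdL T V) D := by
  simpa only [(hasMatJacobianAt_F_L V L S _).matJacobian_eq] using hasMatJacobianAt_dFdL V D

theorem hasMatJacobianAt_matJacobian_F_S :
    HasMatJacobianAt (fun D' => matJacobian (fun S' => F V L S' D') S) 0 D := by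
  simpa only [(hasMatJacobianAt_F_S V L S _).matJacobian_eq] using
    hasMatJacobianAt_const (dFdS n m) D

end Gradients

end DataDrivenLQR

end

/-! ### Assembly of all the blocks -/

open DataDrivenLQR
theorem proposition5 (n m T : ℕ) (Q : Matrix (Fin n) (Fin n) ℝ) (V : Matrix (Fin m) (Fin m) ℝ)
    (γ : ℝ) (L : Matrix (Fin T) (Fin n) ℝ) (S : Matrix (Fin m) (Fin m) ℝ)
    (Λ : Matrix (FIdx n m) (FIdx n m) ℝ) (D : Matrix (DIdx n m) (Fin T) ℝ)
    (hΓ : (GamD D).rank = m + n) :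
    -- `G₁` and `G₂` are well defined: the Lagrangian is differentiable in `L` and in `S`
    (∀ (L' : Matrix (Fin T) (Fin n) ℝ) (S' : Matrix (Fin m) (Fin m) ℝ)
        (Λ' : Matrix (FIdx n m) (FIdx n m) ℝ) (D' : Matrix (DIdx n m) (Fin T) ℝ),
      HasRowDerivAt (fun L'' => lagr Q V γ L'' S' Λ' D') (G1 Q V γ L' S' Λ' D') L' ∧
      HasRowDerivAt (fun S'' => lagr Q V γ L' S'' Λ' D') (G2 Q V γ L' S' Λ' D') S') ∧
    -- first block row
    HasVecJacobianAt (fun L' => G1 Q V γ L' S Λ D)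
      ((2 * γ) • ((1 : Matrix (Fin n) (Fin n) ℝ) ⊗ₖ Proj (GamD D))) L ∧
    HasVecJacobianAt (fun S' => G1 Q V γ L S' Λ D) 0 S ∧
    HasVecJacobianAt (fun Λ' => G1 Q V γ L S Λ' D) (-(dFdL V D)ᵀ) Λ ∧
    HasVecJacobianAt (fun D' => G1 Q V γ L S Λ D')
      (commMat (Fin n) (Fin T) * ((1 : Matrix (Fin T) (Fin T) ℝ) ⊗ₖ (Q * EX n m))
        + (2 * γ) • ((Lᵀ ⊗ₖ (1 : Matrix (Fin T) (Fin T) ℝ)) * dProjdD (GamD D))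
        - eyeKronRow (Fin n × Fin T) (vec Λ) * d2FdDdL T V) D ∧
    -- second block row
    HasVecJacobianAt (fun L' => G2 Q V γ L' S Λ D) 0 L ∧
    HasVecJacobianAt (fun S' => G2 Q V γ L S' Λ D) 0 S ∧
    HasVecJacobianAt (fun Λ' => G2 Q V γ L S Λ' D) (-(dFdS n m)ᵀ) Λ ∧
    HasVecJacobianAt (fun D' => G2 Q V γ L S Λ D')
      (-(eyeKronRow (Fin m × Fin m) (vec Λ)
        * matJacobian (fun D' => matJacobian (fun S' => F V L S' D') S) D)) D ∧
    -- third block row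
    HasMatJacobianAt (fun L' => G3 V L' S Λ D)
      ((Λ ⊗ₖ (1 : Matrix (FIdx n m) (FIdx n m) ℝ)) * dFdL V D) L ∧
    HasMatJacobianAt (fun S' => G3 V L S' Λ D)
      ((Λ ⊗ₖ (1 : Matrix (FIdx n m) (FIdx n m) ℝ)) * dFdS n m) S ∧
    HasMatJacobianAt (fun Λ' => G3 V L S Λ' D)
      (((1 : Matrix (FIdx n m) (FIdx n m) ℝ) ⊗ₖ F V L S D) * commMat (FIdx n m) (FIdx n m)) Λ ∧
    HasMatJacobianAt (fun D' => G3 V L S Λ D')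
      ((Λ ⊗ₖ (1 : Matrix (FIdx n m) (FIdx n m) ℝ)) * dFdD V L) D ∧
    -- fourth block row
    HasMatJacobianAt (fun _ : Matrix (Fin T) (Fin n) ℝ => G4 Λ) 0 L ∧
    HasMatJacobianAt (fun _ : Matrix (Fin m) (Fin m) ℝ => G4 Λ) 0 S ∧
    HasMatJacobianAt (fun Λ' => G4 Λ') (1 - commMat (FIdx n m) (FIdx n m)) Λ ∧
    HasMatJacobianAt (fun _ : Matrix (DIdx n m) (Fin T) ℝ => G4 Λ) 0 D ∧
    -- first derivatives of `F₁`, `F₂`, `F`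
    HasMatJacobianAt (fun L' => F1 V L' S D) (dF1dL V D) L ∧
    HasMatJacobianAt (fun L' => F2 L' D) (dF2dL D) L ∧
    HasMatJacobianAt (fun L' => F V L' S D) (dFdL V D) L ∧
    HasMatJacobianAt (fun S' => F1 V L S' D) (dF1dS n m) S ∧
    HasMatJacobianAt (fun _ : Matrix (Fin m) (Fin m) ℝ => F2 L D) (dF2dS n m) S ∧
    HasMatJacobianAt (fun S' => F V L S' D) (dFdS n m) S ∧
    HasMatJacobianAt (fun D' => F1 V L S D') (dF1dD V L) D ∧
    HasMatJacobianAt (fun D' => F2 L D') (dF2dD m L) D ∧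
    HasMatJacobianAt (fun D' => F V L S D') (dFdD V L) D ∧
    -- second derivatives of `F₁`, `F₂`, `F`
    HasMatJacobianAt (fun D' => matJacobian (fun L' => F1 V L' S D') L) (d2F1dDdL T V) D ∧
    HasMatJacobianAt (fun D' => matJacobian (fun L' => F2 L' D') L) (d2F2dDdL n m T) D ∧
    HasMatJacobianAt (fun D' => matJacobian (fun L' => F V L' S D') L) (d2FdDdL T V) D ∧
    HasMatJacobianAt (fun D' => matJacobian (fun S' => F V L S' D') S) 0 D ∧
    -- derivatives of `Γ`, `Γ†` and `Π`
    HasMatJacobianAt (fun X' => Gam X' (dataU D)) (dGamdX n m T) (dataX D) ∧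
    HasMatJacobianAt (fun U' => Gam (dataX D) U') (dGamdU n m T) (dataU D) ∧
    HasMatJacobianAt (fun Γ' => pinv Γ') (dPinv (GamD D)) (GamD D) ∧
    HasMatJacobianAt (fun X' => Proj (Gam X' (dataU D))) (dProjdX (GamD D)) (dataX D) ∧
    HasMatJacobianAt (fun U' => Proj (Gam (dataX D) U')) (dProjdU (GamD D)) (dataU D) ∧
    HasMatJacobianAt (fun D' => Proj (GamD D')) (dProjdD (GamD D)) D := by
  have hu := isUnit_mul_transpose_of_rank hΓ
  refine ⟨fun L' S' Λ' D' => ⟨?_, ?_⟩, hasVecJacobianAt_G1_L Q V γ L S Λ, ?_,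
    hasVecJacobianAt_G1_Λ Q V γ L S Λ, hasVecJacobianAt_G1_D Q V γ L S Λ hu, ?_, ?_,
    hasVecJacobianAt_G2_Λ Q V γ L S Λ, ?_,
    (hasMatJacobianAt_F_L V L S D).mul_transpose_const Λ,
    (hasMatJacobianAt_F_S V L S D).mul_transpose_const Λ,
    hasMatJacobianAt_G3_Λ V L S Λ D, (hasMatJacobianAt_F_D V L S D).mul_transpose_const Λ,
    hasMatJacobianAt_const _ _, hasMatJacobianAt_const _ _, hasMatJacobianAt_G4 Λ,
    hasMatJacobianAt_const _ _, hasMatJacobianAt_F1_L V L S D, hasMatJacobianAt_F2_L L D,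
    hasMatJacobianAt_F_L V L S D, hasMatJacobianAt_F1_S V L S D, hasMatJacobianAt_F2_S L S D,
    hasMatJacobianAt_F_S V L S D, hasMatJacobianAt_F1_D V L S D, hasMatJacobianAt_F2_D L D,
    hasMatJacobianAt_F_D V L S D, hasMatJacobianAt_matJacobian_F1_L V L S D,
    hasMatJacobianAt_matJacobian_F2_L L D, hasMatJacobianAt_matJacobian_F_L V L S D,
    hasMatJacobianAt_matJacobian_F_S V L S D, hasMatJacobianAt_Gam_X _ _,
    hasMatJacobianAt_Gam_U _ _, hasMatJacobianAt_pinv hu, hasMatJacobianAt_proj_X hu,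
    hasMatJacobianAt_proj_U hu, hasMatJacobianAt_proj_D hu⟩
  · rw [G1_eq]
    exact hasRowDerivAt_lagr_L Q V γ L' S' Λ' D'
  · rw [G2_eq]
    exact hasRowDerivAt_lagr_S Q V γ L' S' Λ' D'
  · simp only [G1_eq]
    exact hasVecJacobianAt_const _ _
  · simp only [G2_eq]
    exact hasVecJacobianAt_const _ _
  · simp only [G2_eq]
    exact hasVecJacobianAt_const _ _
  · rw [(hasMatJacobianAt_matJacobian_F_S V L S D).matJacobian_eq, Matrix.mul_zero, neg_zero]
    simp only [G2_eq]
    exact hasVecJacobianAt_const _ _
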